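/- A graph on a topological space $X$ is a symmetric irreflexive relation $G\subseteq X^2$. Write $(X,G)\preceq_c(Y,H)$ (resp. $(X,G)\preceq_c^i(Y,H)$) if there is a continuous (resp. injective continuous) map $\varphi:X\to Y$ with $(\varphi(x),\varphi(y))\in H$ whenever $(x,y)\in G$. A 0DMC space is a zero-dimensional metrizable compact space. For a class $\Gamma$ of subsets of $X$, the $\Gamma$ chromatic number of $(X,G)$ is the least cardinal $\kappa\le\aleph_0$ for which there is $f:X\to\kappa$ with $f(x)\ne f(y)$ whenever $(x,y)\in G$ and with $f^{-1}(A)\in\Gamma$ for every $A\subseteq\kappa$, if there is such a $\kappa$, and $2^{\aleph_0}$ otherwise. The continuous chromatic number (CCN) is the case where $\Gamma$ is the class of open sets. $D_2(\mathbf{\Pi}^0_1)$ is the class of differences of two closed sets, and $\mathbf{\Sigma}^0_1\oplus\mathbf{\Pi}^0_1$ is the class of sets $(O\cap C)\cup(F\setminus C)$ with $C$ clopen, $O$ open and $F$ closed. Let $\mathfrak{K}$ be the class of graphs on a 0DMC space with CCN at least three. An element $(X,G)$ of $\mathfrak{K}$ is $\preceq_c^i$-minimal in $\mathfrak{K}$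 if $(X,G)\preceq_c^i(Y,H)$ for each $(Y,H)\in\mathfrak{K}$ with $(Y,H)\preceq_c^i(X,G)$. A $\preceq_c^i$-basis for $\mathfrak{K}$ is a subclass $\mathfrak{B}$ of $\mathfrak{K}$ such that each element of $\mathfrak{K}$ is $\preceq_c^i$-above an element of $\mathfrak{B}$. Let $\mathfrak{D}$ be the set of sequences $\mathbf{d}=(d_j)_{j\in\omega}$ of integers at least two with $d_0=2$ and $d_j$ odd for $j\ge1$. For $\mathbf{d}\in\mathfrak{D}$, let $o$ be the odometer (addition of one to the coordinate $0$, with carry to the right) of $\prod_{j}\{0,\dots,d_j-1\}$, let $n_l:=\frac{(\prod_{1\le j\le l}d_j)-1}{2}$, and let $o_{l,i}$ be the word formed by the first $l+1$ coordinates of $o^i(0^\infty)$. Fix three distinct letters $c,a,\overline{a}$ not in $\omega$, and let $\mathbb{G}_{\mathbf{d}}$ be the symmetrization of the set of pairs, for $l\in\omega$, $$(c^{l+1}a\overline{a}^\infty,\,o_{l,0}\overline{a}a^\infty),\qquad (o_{l,i}a^{i+1}\overline{a}^\infty,\,o_{l,i+1}\overline{a}^{i+2}a^\infty)\ \ (0\le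 i\le 2n_l),\qquad (o_{l,2n_l+1}a^{2n_l+2}\overline{a}^\infty,\,c^{l+1}\overline{a}a^\infty),$$ viewed as a graph on the closure $\mathbb{K}_{\mathbf{d}}$ of its set of endpoints in the product space $(\omega\cup\{c,a,\overline{a}\})^\omega$, where the alphabet is discrete. **Theorem.** There is a family $(\mathbf{d}_\alpha)_{\alpha\in 2^\omega}$ of elements of $\mathfrak{D}$ such that, with $(\mathbb{K}_\alpha,\mathbb{G}_\alpha):=(\mathbb{K}_{\mathbf{d}_\alpha},\mathbb{G}_{\mathbf{d}_\alpha})$, the family $\big((\mathbb{K}_\alpha,\mathbb{G}_\alpha)\big)_{\alpha\in 2^\omega}$ is a $\preceq_c$-antichain (and thus a $\preceq_c^i$-antichain), i.e. $(\mathbb{K}_\alpha,\mathbb{G}_\alpha)\not\preceq_c(\mathbb{K}_\beta,\mathbb{G}_\beta)$ if $\alpha\ne\beta$, and, for each $\alpha\in 2^\omega$, (a) $\mathbb{K}_\alpha$ is a 0DMC space, (b) $\mathbb{G}_\alpha$ is a countable $D_2(\mathbf{\Pi}^0_1)$ subset of $\mathbb{K}_\alpha^2$, with CCN three and $\mathbf{\Sigma}^0_1\oplus\mathbf{\Pi}^0_1$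 chromatic number two, and the vertices of $\mathbb{G}_\alpha$ have degree at most one, (c) $(\mathbb{K}_\alpha,\mathbb{G}_\alpha)$ is $\preceq_c^i$-minimal in $\mathfrak{K}$. In particular, any $\preceq_c^i$-basis for $\mathfrak{K}$ has size at least continuum. -/

import Mathlib

open Cardinal

universe u v

/-! ### Graphs on topological spaces, homomorphisms, chromatic numbers -/

/-- A topological space together with a graph (a symmetric irreflexive relation) on it. -/
structure TopGraph : Type (u + 1) where
  /-- the underlying set of the space, i.e. the set of vertices -/
  carrier : Type u
  /-- the topology of the space -/
  [top : TopologicalSpace carrier]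
  /-- the graph -/
  graph : SimpleGraph carrier

attribute [instance] TopGraph.top

namespace TopGraph

/-- The graph, as a subset of the square of the space (equipped with the product topology). -/
def edges (X : TopGraph.{u}) : Set (X.carrier × X.carrier) :=
  {p | X.graph.Adj p.1 p.2}

/-- `X ≼_c Y`: there is a continuous homomorphism from `X` into `Y`. -/
def ContLE (X : TopGraph.{u}) (Y : TopGraph.{v}) : Prop :=
  ∃ φ : X.carrier → Y.carrier, Continuous φ ∧
    ∀ x y, X.graph.Adj x y → Y.graph.Adj (φ x) (φ y)

/-- `X ≼_c^i Y`: there is an injective continuous homomorphism from `X` into `Y`. -/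
def InjContLE (X : TopGraph.{u}) (Y : TopGraph.{v}) : Prop :=
  ∃ φ : X.carrier → Y.carrier, Function.Injective φ ∧ Continuous φ ∧
    ∀ x y, X.graph.Adj x y → Y.graph.Adj (φ x) (φ y)

/-- The cardinals `κ ≤ ℵ₀` such that the graph has a coloring with values in a discrete space of
size `κ` which is measurable with respect to the class `Γ` of subsets of the space: the preimage
of every (automatically open) set of colors belongs to `Γ`. -/
def colorCardinals (X : TopGraph.{u}) (Γ : Set (Set X.carrier)) : Set Cardinal.{0} :=
  {κ | κ ≤ ℵ₀ ∧ ∃ C : Type, #C = κ ∧ ∃ f : X.carrier → C,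
    (∀ A : Set C, f ⁻¹' A ∈ Γ) ∧ ∀ x y, X.graph.Adj x y → f x ≠ f y}

open Classical in
/-- The `Γ`-chromatic number: the minimum of the preceding cardinals if there is one, `2^ℵ₀`
otherwise. -/
noncomputable def chromaticNumber (X : TopGraph.{u}) (Γ : Set (Set X.carrier)) : Cardinal.{0} :=
  if (X.colorCardinals Γ).Nonempty then sInf (X.colorCardinals Γ) else 𝔠

/-- The continuous chromatic number (a map into a discrete space is continuous when the preimages
of all sets of colors are open). -/
noncomputable def ccn (X : TopGraph.{u}) : Cardinal.{0} :=
  X.chromaticNumber {s | IsOpen s}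

/-- The space is zero-dimensional (it has a basis of clopen sets), metrizable and compact. -/
def IsZeroDimMetrizableCompact (X : TopGraph.{u}) : Prop :=
  TopologicalSpace.IsTopologicalBasis {s : Set X.carrier | IsClopen s} ∧
    TopologicalSpace.MetrizableSpace X.carrier ∧ CompactSpace X.carrier

/-- All the vertices have degree at most one. -/
def DegreeLEOne (X : TopGraph.{u}) : Prop :=
  ∀ x, (X.graph.neighborSet x).encard ≤ 1

end TopGraph

/-- The differences of two closed subsets of a topological space. -/
def D2Closed (Y : Type u) [TopologicalSpace Y] : Set (Set Y) :=
  {s | ∃ A B : Set Y, IsClosed A ∧ IsClosed B ∧ s = A \ B}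

/-- The sets `(O ∩ C) ∪ (F \ C)` with `C` clopen, `O` open and `F` closed. -/
def OpenPlusClosed (Y : Type u) [TopologicalSpace Y] : Set (Set Y) :=
  {s | ∃ C O F : Set Y, IsClopen C ∧ IsOpen O ∧ IsClosed F ∧ s = (O ∩ C) ∪ (F \ C)}

/-- The class of graphs on a zero-dimensional metrizable compact space with continuous chromatic
number at least three. -/
def classK : Set TopGraph.{u} :=
  {X | X.IsZeroDimMetrizableCompact ∧ 3 ≤ X.ccn}

/-- `X` belongs to the class and is `≼_c^i`-minimal in it. The elements of the class that `X` is
compared with may live in another universe. -/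
def IsInjMinimalInK (X : TopGraph.{v}) : Prop :=
  X ∈ classK.{v} ∧ ∀ Y : TopGraph.{u}, Y ∈ classK.{u} → Y.InjContLE X → X.InjContLE Y

/-- `B` is a `≼_c^i`-basis for the class: a subclass such that any element of the class is above
an element of `B`. -/
def IsInjBasisForK (B : Set TopGraph.{u}) : Prop :=
  B ⊆ classK.{u} ∧ ∀ X ∈ classK.{u}, ∃ Y ∈ B, Y.InjContLE X

/-! ### The graph associated with an odometer -/

/-- The sequences `d` of integers at least two with `d 0 = 2` and `d j` odd for `j ≥ 1`. -/
def IsOdometerSeq (d : ℕ → ℕ) : Prop :=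
  d 0 = 2 ∧ ∀ j, 1 ≤ j → 2 ≤ d j ∧ Odd (d j)

/-- The odometer of `∏ j, {0, …, d j - 1}`, which adds one to the coordinate zero with carry to the
right. (It is given by a formula on all of `ℕ → ℕ`, and is applied only to points of this
product.) -/
def odometer (d : ℕ → ℕ) (x : ℕ → ℕ) : ℕ → ℕ := fun n =>
  if ∀ j < n, x j = d j - 1 then (if x n = d n - 1 then 0 else x n + 1) else x n

/-- The alphabet: the natural numbers and three more letters `c`, `a`, `ā`, with the discrete
topology. -/
inductive Letter : Type
  | num (n : ℕ)
  | c
  | a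
  | abar

instance : TopologicalSpace Letter := ⊥

instance : DiscreteTopology Letter := ⟨rfl⟩

/-- The infinite words, with the product topology. -/
abbrev InfWord : Type := ℕ → Letter

/-- The constant word `c^∞`. -/
def cInf : InfWord := fun _ => Letter.c

/-- The point `o^i(0^∞)`, where `o` is the odometer. -/
def odoPoint (d : ℕ → ℕ) (i : ℕ) : InfWord :=
  fun n => Letter.num (((odometer d)^[i] (fun _ => 0)) n)

/-- The word `(s 0) … (s l) a^k ā^∞`. -/
def wordA (s : InfWord) (l k : ℕ) : InfWord :=
  fun n => if n ≤ l then s n else if n ≤ l + k then Letter.a else Letter.abar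

/-- The word `(s 0) … (s l) ā^k a^∞`. -/
def wordAbar (s : InfWord) (l k : ℕ) : InfWord :=
  fun n => if n ≤ l then s n else if n ≤ l + k then Letter.abar else Letter.a

/-- The number `n_l`, so that `2 * n_l + 1 = d 1 * ⋯ * d l` if `d 1, …, d l` are odd. -/
def halfLength (d : ℕ → ℕ) (l : ℕ) : ℕ :=
  ((∏ j ∈ Finset.Icc 1 l, d j) - 1) / 2

/-- The oriented graph associated with the odometer: at each level `l`, the odd cycle
`c, 0^∞, o(0^∞), …, o^{2 n_l + 1}(0^∞), c` is approximated by pairwise disjoint arcs. -/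
inductive OdoArc (d : ℕ → ℕ) : InfWord → InfWord → Prop
  | first (l : ℕ) : OdoArc d (wordA cInf l 1) (wordAbar (odoPoint d 0) l 1)
  | step (l i : ℕ) (hi : i ≤ 2 * halfLength d l) :
      OdoArc d (wordA (odoPoint d i) l (i + 1)) (wordAbar (odoPoint d (i + 1)) l (i + 2))
  | last (l : ℕ) :
      OdoArc d (wordA (odoPoint d (2 * halfLength d l + 1)) l (2 * halfLength d l + 2))
        (wordAbar cInf l 1)

theorem OdoArc.ne {d : ℕ → ℕ} {x y : InfWord} (h : OdoArc d x y) : x ≠ y := by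
  intro e
  cases h with
  | first l => simpa [wordA, wordAbar] using congrFun e (l + 1)
  | step l i hi => simpa [wordA, wordAbar] using congrFun e (l + 1)
  | last l => simpa [wordA, wordAbar] using congrFun e (l + 1)

/-- The space of vertices: the closure of the set of endpoints of the arcs. -/
def odoSpace (d : ℕ → ℕ) : Set InfWord :=
  closure {x | ∃ y, OdoArc d x y ∨ OdoArc d y x}

/-- The symmetrization of the oriented graph, on the preceding space. -/
def odoTopGraph (d : ℕ → ℕ) : TopGraph.{0} where
  carrier := odoSpace d
  graph :=
    { Adj := fun x y => OdoArc d x.1 y.1 ∨ OdoArc d y.1 x.1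
      symm := ⟨fun _ _ h => h.symm⟩
      loopless := ⟨fun _ h => h.elim (fun h => h.ne rfl) (fun h => h.ne rfl)⟩ }

/-! Write P_l for `oddPart d l` = d_1⋯d_l and M_n for `radixProd d n` = d_0⋯d_{n-1}, so that M_{l+1}
= 2 P_l. The arcs of level l approximate the cycle c^∞, 0^∞, o(0^∞), …, o^{P_l}(0^∞), c^∞, whose
length P_l + 2 is odd. By compactness, a continuous two-coloring depends on a prefix of fixed
length, so it would two-color the cycle of some level; hence the CCN is at least three. The markers
in a and ā make the endpoints isolated and pairwise distinct, so the graph is open, the degrees are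
at most one, and the only other points are c^∞ and the points of the odometer.

Minimality. Suppose that Y has CCN at least three and maps injectively into the graph. For any arc
and any level, some coloring depending on a prefix is proper on all arcs of large level except those
close to the given arc; since it cannot color Y, the image of Y contains arcs of arbitrarily large
level close to the given one (`exists_close_arc`). Sending every arc to such an arc, with pairwise
distinct levels, and fixing the other points gives a continuous injection into the image of Y, which
lifts to Y by compactness.

Antichain. A continuous homomorphism between two such graphs sends consecutive points of the orbit
of 0^∞ to pairs in the closure of the target graph. This closure is bipartite
(`LimEdge.limColor_ne`), and a neighbor in it is determined by its first two letters
(`LimEdge.eq_of_agree`). If the image of the orbit came back to a point after a suitable period M_k,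
it would be periodic and yield a closed walk of odd length, which is impossible. So the image stays
in the target odometer and moves by steps ±1, the signs being periodic, with a nonzero sum s over a
period. Uniform continuity then makes every M'_m divide some s M_k (`exists_dvd_of_contLE`): up to
finitely many, the primes of the target sequence occur in the source sequence. Primes coding the
initial segments of α ∈ 2^ω violate this for distinct α, β.

Bases. A member of a basis below the graph of α is also above it by minimality, so by the antichain
property distinct α require distinct members. -/

/-! ### Prefixes of infinite words -/

/-- The two words have the same first `n` letters. -/
def Agree (n : ℕ) (x y : InfWord) : Prop := ∀ j < n, x j = y j

namespace Agree

variable {n m : ℕ} {x y z : InfWord}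

theorem refl (n : ℕ) (x : InfWord) : Agree n x x := fun _ _ => rfl

theorem symm (h : Agree n x y) : Agree n y x := fun j hj => (h j hj).symm

theorem trans (h : Agree n x y) (h' : Agree n y z) : Agree n x z :=
  fun j hj => (h j hj).trans (h' j hj)

theorem mono (hmn : m ≤ n) (h : Agree n x y) : Agree m x y := fun j hj => h j (hj.trans_le hmn)

end Agree

theorem eq_of_forall_agree {x y : InfWord} (h : ∀ n, Agree n x y) : x = y :=
  funext fun j => h (j + 1) j j.lt_succ_self

theorem isOpen_setOf_agree (n : ℕ) (x : InfWord) : IsOpen {y | Agree n x y} := by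
  have : {y | Agree n x y} = ⋂ j ∈ Finset.range n, {y : InfWord | y j = x j} := by
    ext y
    simp [Agree, eq_comm]
  rw [this]
  exact isOpen_biInter_finset fun j _ =>
    (isOpen_discrete {x j}).preimage (continuous_apply (A := fun _ : ℕ => Letter) j)

theorem exists_agree_subset {U : Set InfWord} (hU : IsOpen U) {x : InfWord} (hx : x ∈ U) :
    ∃ n, ∀ y, Agree n x y → y ∈ U := by
  obtain ⟨I, u, hu, hsub⟩ := isOpen_pi_iff.1 hU x hx
  refine ⟨I.sup id + 1, fun y hy => hsub fun j hj => ?_⟩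
  rw [← hy j (Nat.lt_succ_of_le (Finset.le_sup (f := id) hj))]
  exact (hu j hj).2

theorem mem_closure_iff_agree {S : Set InfWord} {x : InfWord} :
    x ∈ closure S ↔ ∀ n, ∃ y ∈ S, Agree n x y := by
  rw [mem_closure_iff]
  constructor
  · intro h n
    obtain ⟨y, hy, hyS⟩ := h _ (isOpen_setOf_agree n x) (Agree.refl n x)
    exact ⟨y, hyS, hy⟩
  · intro h U hU hx
    obtain ⟨n, hn⟩ := exists_agree_subset hU hx
    obtain ⟨y, hyS, hy⟩ := h n
    exact ⟨y, hn y hy, hyS⟩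

theorem continuous_subtype_iff_agree {S : Set InfWord} {f : S → InfWord} :
    Continuous f ↔ ∀ x : S, ∀ m, ∃ n, ∀ y : S, Agree n x.1 y.1 → Agree m (f x) (f y) := by
  constructor
  · intro hf x m
    obtain ⟨U, hU, hU'⟩ := isOpen_induced_iff.1 ((isOpen_setOf_agree m (f x)).preimage hf)
    have hx : x.1 ∈ U := by
      change x ∈ Subtype.val ⁻¹' U
      rw [hU']
      exact Agree.refl _ _
    obtain ⟨n, hn⟩ := exists_agree_subset hU hx
    refine ⟨n, fun y hy => ?_⟩
    have : y ∈ Subtype.val ⁻¹' U := hn _ hy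
    rw [hU'] at this
    exact this
  · intro h
    refine continuous_iff_continuousAt.2 fun x => ?_
    intro V hV
    obtain ⟨W, hWV, hW, hxW⟩ := mem_nhds_iff.1 hV
    obtain ⟨m, hm⟩ := exists_agree_subset hW hxW
    obtain ⟨n, hn⟩ := h x m
    have hnx : {y : S | Agree n x.1 y.1} ∈ nhds x :=
      ((isOpen_setOf_agree n x.1).preimage continuous_subtype_val).mem_nhds (Agree.refl n x.1)
    exact Filter.mem_map.2 (Filter.mem_of_superset hnx fun y hy => hWV (hm _ (hn y hy)))

/-! ### Mixed radix expansions -/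

/-- The product `d 0 * ⋯ * d (n - 1)`. -/
def radixProd (d : ℕ → ℕ) (n : ℕ) : ℕ := ∏ j ∈ Finset.range n, d j

/-- The odd number `d 1 * ⋯ * d l`. -/
def oddPart (d : ℕ → ℕ) (l : ℕ) : ℕ := 2 * halfLength d l + 1

namespace IsOdometerSeq

variable {d : ℕ → ℕ}

theorem two_le (hd : IsOdometerSeq d) (j : ℕ) : 2 ≤ d j := by
  rcases Nat.eq_zero_or_pos j with rfl | h
  · exact hd.1.ge
  · exact (hd.2 j h).1

theorem odd_prod (hd : IsOdometerSeq d) (l : ℕ) : Odd (∏ j ∈ Finset.Icc 1 l, d j) :=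
  Finset.prod_induction _ Odd (fun _ _ => Odd.mul) odd_one
    fun j hj => (hd.2 j (Finset.mem_Icc.1 hj).1).2

theorem oddPart_eq (hd : IsOdometerSeq d) (l : ℕ) : oddPart d l = ∏ j ∈ Finset.Icc 1 l, d j := by
  obtain ⟨t, ht⟩ := hd.odd_prod l
  rw [oddPart, halfLength, ht]
  omega

theorem oddPart_succ (hd : IsOdometerSeq d) (l : ℕ) :
    oddPart d (l + 1) = oddPart d l * d (l + 1) := by
  rw [hd.oddPart_eq, hd.oddPart_eq, Finset.prod_Icc_succ_top (by omega)]

theorem radixProd_succ_eq (hd : IsOdometerSeq d) (l : ℕ) : radixProd d (l + 1) = 2 * oddPart d l := by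
  induction l with
  | zero => simp [radixProd, oddPart, halfLength, hd.1]
  | succ l ih => rw [radixProd, Finset.prod_range_succ, ← radixProd, ih, hd.oddPart_succ, mul_assoc]

end IsOdometerSeq

theorem radixProd_zero (d : ℕ → ℕ) : radixProd d 0 = 1 := rfl

theorem radixProd_succ (d : ℕ → ℕ) (n : ℕ) : radixProd d (n + 1) = radixProd d n * d n :=
  Finset.prod_range_succ _ _

theorem radixProd_dvd (d : ℕ → ℕ) {m n : ℕ} (h : m ≤ n) : radixProd d m ∣ radixProd d n :=
  Finset.prod_dvd_prod_of_subset _ _ _ (Finset.range_mono h)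

theorem oddPart_odd (d : ℕ → ℕ) (l : ℕ) : Odd (oddPart d l) := ⟨_, rfl⟩

theorem oddPart_pos (d : ℕ → ℕ) (l : ℕ) : 0 < oddPart d l := Nat.succ_pos _

namespace IsOdometerSeq

variable {d : ℕ → ℕ}

theorem radixProd_pos (hd : IsOdometerSeq d) (n : ℕ) : 0 < radixProd d n :=
  Finset.prod_pos fun j _ => by have := hd.two_le j; omega

theorem radixProd_one (hd : IsOdometerSeq d) : radixProd d 1 = 2 := by
  simp [radixProd, hd.1]

theorem lt_radixProd (hd : IsOdometerSeq d) (n : ℕ) : n < radixProd d n := by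
  induction n with
  | zero => exact hd.radixProd_pos 0
  | succ n ih =>
    rw [radixProd_succ]
    have := Nat.mul_le_mul_left (radixProd d n) (hd.two_le n)
    omega

/-- As d_{l+1} is odd, P_{l+1} - P_l = P_l (d_{l+1} - 1) is a multiple of 2 P_l = M_{l+1}. Thus the
points o^{P_l}(0^∞), where the cycles return to c^∞, converge in the odometer. -/
theorem oddPart_modEq (hd : IsOdometerSeq d) {n l : ℕ} (h : n ≤ l) :
    oddPart d l ≡ oddPart d n [MOD radixProd d (n + 1)] := by
  induction l, h using Nat.le_induction with
  | base => rfl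
  | succ l h ih =>
    refine Nat.ModEq.trans ?_ ih
    obtain ⟨t, ht⟩ := (hd.2 (l + 1) (by omega)).2
    have : oddPart d (l + 1) = oddPart d l + radixProd d (l + 1) * t := by
      rw [hd.oddPart_succ, ht, hd.radixProd_succ_eq]
      ring
    rw [this]
    refine (Nat.modEq_iff_dvd' (Nat.le_add_right _ _)).2 ?_ |>.symm
    rw [Nat.add_sub_cancel_left]
    exact (radixProd_dvd d (by omega)).mul_right t

theorem lt_oddPart (hd : IsOdometerSeq d) (l : ℕ) : l < oddPart d l := by
  induction l with
  | zero => exact oddPart_pos d 0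
  | succ n ih =>
    rw [hd.oddPart_succ]
    have := Nat.mul_le_mul_left (oddPart d n) (hd.two_le (n + 1))
    omega

/-- This is the carry condition: all the digits before n are maximal exactly when adding one resets
them to zero. -/
theorem forall_digit_eq_iff (hd : IsOdometerSeq d) (i n : ℕ) :
    (∀ j < n, i / radixProd d j % d j = d j - 1) ↔ radixProd d n ∣ i + 1 := by
  induction n with
  | zero => simp [radixProd_zero]
  | succ n ih =>
    have h2 := hd.two_le n
    rw [Nat.forall_lt_succ_right, ih, radixProd_succ]
    constructor
    · rintro ⟨h1, h⟩
      have hs : (i + 1) / radixProd d n = i / radixProd d n + 1 := Nat.succ_div_of_dvd h1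
      obtain ⟨t, ht⟩ := h1
      rw [ht] at hs ⊢
      refine Nat.mul_dvd_mul_left _ ?_
      rw [Nat.mul_div_cancel_left _ (hd.radixProd_pos n)] at hs
      rw [hs, Nat.dvd_iff_mod_eq_zero, Nat.add_mod, h, Nat.mod_eq_of_lt (show 1 < d n by omega),
        Nat.sub_add_cancel (by omega), Nat.mod_self]
    · intro h
      have h1 : radixProd d n ∣ i + 1 := dvd_of_mul_right_dvd h
      refine ⟨h1, ?_⟩
      have hs : (i + 1) / radixProd d n = i / radixProd d n + 1 := Nat.succ_div_of_dvd h1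
      obtain ⟨t, ht⟩ := h
      rw [ht, mul_assoc, Nat.mul_div_cancel_left _ (hd.radixProd_pos n)] at hs
      have ht0 : 0 < t := by
        rcases Nat.eq_zero_or_pos t with rfl | h0
        · simp at ht
        · exact h0
      obtain ⟨t, rfl⟩ := Nat.exists_eq_succ_of_ne_zero ht0.ne'
      have : i / radixProd d n = d n - 1 + d n * t := by
        rw [Nat.mul_succ] at hs
        omega
      rw [this, Nat.add_mul_mod_self_left, Nat.mod_eq_of_lt (by omega)]

theorem iterate_odometer (hd : IsOdometerSeq d) (i : ℕ) :
    (odometer d)^[i] (fun _ => 0) = fun n => i / radixProd d n % d n := by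
  induction i with
  | zero => simp
  | succ i ih =>
    rw [Function.iterate_succ_apply', ih]
    funext n
    have h2 := hd.two_le n
    simp only [odometer, hd.forall_digit_eq_iff]
    by_cases h : radixProd d n ∣ i + 1
    · rw [if_pos h, Nat.succ_div_of_dvd h]
      split_ifs with h'
      · rw [Nat.add_mod, h', Nat.mod_eq_of_lt (show 1 < d n by omega),
          Nat.sub_add_cancel (by omega), Nat.mod_self]
      · have := Nat.mod_lt (i / radixProd d n) (show d n > 0 by omega)
        rw [Nat.add_mod, Nat.mod_eq_of_lt (show 1 < d n by omega), Nat.mod_eq_of_lt (a := _ + 1)]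
        omega
    · rw [if_neg h, Nat.succ_div_of_not_dvd h]

theorem odoPoint_apply (hd : IsOdometerSeq d) (i n : ℕ) :
    odoPoint d i n = Letter.num (i / radixProd d n % d n) := by
  rw [odoPoint, hd.iterate_odometer]

theorem agree_odoPoint_iff (hd : IsOdometerSeq d) (n i j : ℕ) :
    Agree n (odoPoint d i) (odoPoint d j) ↔ i ≡ j [MOD radixProd d n] := by
  induction n with
  | zero => simp [Agree, radixProd_zero, Nat.modEq_one]
  | succ n ih =>
    have h1 : Agree (n + 1) (odoPoint d i) (odoPoint d j) ↔
        Agree n (odoPoint d i) (odoPoint d j) ∧ odoPoint d i n = odoPoint d j n :=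
      Nat.forall_lt_succ_right
    rw [h1, ih, hd.odoPoint_apply, hd.odoPoint_apply, Letter.num.injEq, radixProd_succ, Nat.ModEq,
      Nat.ModEq, Nat.mod_mul, Nat.mod_mul (x := j)]
    constructor
    · rintro ⟨h, h'⟩
      rw [h, h']
    · intro h
      have e : i % radixProd d n = j % radixProd d n := by
        have := congrArg (· % radixProd d n) h
        simpa using this
      refine ⟨e, ?_⟩
      rw [e] at h
      exact Nat.eq_of_mul_eq_mul_left (hd.radixProd_pos n) (Nat.add_left_cancel h)

end IsOdometerSeq

/-- The digit in a letter. -/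
def Letter.digit : Letter → ℕ
  | .num n => n
  | _ => 0

/-- The number whose mixed radix expansion is the prefix of length `n`. -/
def prefixVal (d : ℕ → ℕ) (n : ℕ) (w : InfWord) : ℕ :=
  ∑ j ∈ Finset.range n, radixProd d j * (w j).digit

theorem prefixVal_congr (d : ℕ → ℕ) {n : ℕ} {w w' : InfWord} (h : Agree n w w') :
    prefixVal d n w = prefixVal d n w' :=
  Finset.sum_congr rfl fun j hj => by rw [h j (Finset.mem_range.1 hj)]

theorem IsOdometerSeq.prefixVal_odoPoint {d : ℕ → ℕ} (hd : IsOdometerSeq d) (n i : ℕ) :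
    prefixVal d n (odoPoint d i) = i % radixProd d n := by
  induction n with
  | zero => simp [prefixVal, radixProd_zero, Nat.mod_one]
  | succ n ih =>
    rw [prefixVal, Finset.sum_range_succ, ← prefixVal, ih, hd.odoPoint_apply, radixProd_succ,
      Nat.mod_mul, Letter.digit]

/-! ### The arcs -/

/-- The vertices of the odd cycle of the level `l`: the infinite word `c^∞` for `e = 0` and
`e = oddPart d l + 2`, and the points of the orbit of `0^∞` in between. -/
def cycleVertex (d : ℕ → ℕ) (l e : ℕ) : InfWord :=
  if e = 0 ∨ oddPart d l + 1 < e then cInf else odoPoint d (e - 1)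

/-- The length of the marker that follows the prefix of a vertex of the odd cycle. -/
def markerLength (d : ℕ → ℕ) (l e : ℕ) : ℕ :=
  if e = 0 ∨ oddPart d l + 1 < e then 1 else e

/-- The source of the arc number `e` of the level `l`. -/
def arcSource (d : ℕ → ℕ) (l e : ℕ) : InfWord :=
  wordA (cycleVertex d l e) l (markerLength d l e)

/-- The target of the arc number `e` of the level `l`. -/
def arcTarget (d : ℕ → ℕ) (l e : ℕ) : InfWord :=
  wordAbar (cycleVertex d l (e + 1)) l (markerLength d l (e + 1))

/-- There is an arc number `e` at the level `l`. -/
def IsArcIndex (d : ℕ → ℕ) (l e : ℕ) : Prop := e ≤ oddPart d l + 1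

/-- The three kinds of arcs become one: the arc number e joins copies of the vertices e and e + 1 of
the cycle, with 0 ≤ e ≤ P_l + 1. -/
theorem odoArc_iff {d : ℕ → ℕ} {x y : InfWord} :
    OdoArc d x y ↔ ∃ l e, IsArcIndex d l e ∧ x = arcSource d l e ∧ y = arcTarget d l e := by
  constructor
  · intro h
    cases h with
    | first l =>
      refine ⟨l, 0, Nat.zero_le _, ?_, ?_⟩ <;>
        simp [arcSource, arcTarget, cycleVertex, markerLength]
    | step l i hi =>
      have h1 : ¬ (oddPart d l + 1 < i + 1) := by unfold oddPart; omega
      have h2 : ¬ (oddPart d l + 1 < i + 1 + 1) := by unfold oddPart; omega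
      refine ⟨l, i + 1, by unfold IsArcIndex oddPart; omega, ?_, ?_⟩ <;>
        simp [arcSource, arcTarget, cycleVertex, markerLength, h1, h2]
    | last l =>
      refine ⟨l, oddPart d l + 1, le_rfl, ?_, ?_⟩ <;>
        simp [arcSource, arcTarget, cycleVertex, markerLength, oddPart]
  · rintro ⟨l, e, he, rfl, rfl⟩
    unfold IsArcIndex at he
    rcases Nat.eq_zero_or_pos e with rfl | h0
    · convert OdoArc.first (d := d) l using 1 <;>
        simp [arcSource, arcTarget, cycleVertex, markerLength]
    obtain ⟨i, rfl⟩ := Nat.exists_eq_add_of_lt h0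
    simp only [zero_add] at he ⊢
    rcases Nat.lt_or_ge i (oddPart d l) with h | h
    · have h1 : ¬ (oddPart d l + 1 < i + 1) := by omega
      have h2 : ¬ (oddPart d l + 1 < i + 1 + 1) := by omega
      convert OdoArc.step (d := d) l i (by unfold oddPart at h; omega) using 1 <;>
        simp [arcSource, arcTarget, cycleVertex, markerLength, h1, h2]
    · obtain rfl : i = oddPart d l := by omega
      convert OdoArc.last (d := d) l using 1 <;>
        simp [arcSource, arcTarget, cycleVertex, markerLength, oddPart]

theorem odoArc_arc {d : ℕ → ℕ} {l e : ℕ} (he : IsArcIndex d l e) :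
    OdoArc d (arcSource d l e) (arcTarget d l e) :=
  odoArc_iff.2 ⟨l, e, he, rfl, rfl⟩

section cycleVertex

variable {d : ℕ → ℕ} {l : ℕ}

@[simp] theorem cycleVertex_zero : cycleVertex d l 0 = cInf := by simp [cycleVertex]

@[simp] theorem cycleVertex_last : cycleVertex d l (oddPart d l + 2) = cInf := by
  simp [cycleVertex]

theorem cycleVertex_succ {i : ℕ} (h : i ≤ oddPart d l) :
    cycleVertex d l (i + 1) = odoPoint d i := by
  simp [cycleVertex, h]

theorem IsArcIndex.cases {e : ℕ} (h : IsArcIndex d l e) :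
    e = 0 ∨ (∃ i < oddPart d l, e = i + 1) ∨ e = oddPart d l + 1 := by
  unfold IsArcIndex at h
  rcases Nat.eq_zero_or_pos e with h0 | h0
  · exact Or.inl h0
  · rcases h.lt_or_eq with h1 | h1
    · exact Or.inr (Or.inl ⟨e - 1, by omega, by omega⟩)
    · exact Or.inr (Or.inr h1)

/-- The letter is neither `a` nor `ā`. -/
def Letter.IsPlain (x : Letter) : Prop := x ≠ .a ∧ x ≠ .abar

theorem isPlain_cInf (n : ℕ) : (cInf n).IsPlain := by constructor <;> simp [cInf]

theorem isPlain_odoPoint (i n : ℕ) : (odoPoint d i n).IsPlain := by constructor <;> simp [odoPoint]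

theorem isPlain_cycleVertex (e n : ℕ) : (cycleVertex d l e n).IsPlain := by
  unfold cycleVertex
  split_ifs
  · exact isPlain_cInf n
  · exact isPlain_odoPoint _ n

theorem markerLength_pos (e : ℕ) : 0 < markerLength d l e := by
  unfold markerLength
  split_ifs <;> omega

theorem agree_arcSource (e : ℕ) : Agree (l + 1) (arcSource d l e) (cycleVertex d l e) :=
  fun j hj => by simp [arcSource, wordA, Nat.lt_succ_iff.1 hj]

theorem agree_arcTarget (e : ℕ) : Agree (l + 1) (arcTarget d l e) (cycleVertex d l (e + 1)) :=
  fun j hj => by simp [arcTarget, wordAbar, Nat.lt_succ_iff.1 hj]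

theorem arcSource_marker (e : ℕ) : arcSource d l e (l + 1) = Letter.a := by
  have := markerLength_pos (d := d) (l := l) e
  simp [arcSource, wordA, this, Nat.succ_le_iff]

theorem arcTarget_marker (e : ℕ) : arcTarget d l e (l + 1) = Letter.abar := by
  have := markerLength_pos (d := d) (l := l) (e + 1)
  simp [arcTarget, wordAbar, this, Nat.succ_le_iff]

theorem cInf_ne_odoPoint (i n : ℕ) : cInf n ≠ odoPoint d i n := by simp [cInf, odoPoint]

/-- The exponents of the orbit points on the cycle are at most P_l < 2 P_l = M_{l+1}, so l + 1
letters separate them; the only repetition is c^∞, at both ends. -/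
theorem cycleVertex_eq_of_agree (hd : IsOdometerSeq d) {e e' : ℕ}
    (h : Agree (l + 1) (cycleVertex d l e) (cycleVertex d l e')) :
    ((e = 0 ∨ oddPart d l + 1 < e) ∧ (e' = 0 ∨ oddPart d l + 1 < e')) ∨ e = e' := by
  by_cases h1 : e = 0 ∨ oddPart d l + 1 < e <;> by_cases h2 : e' = 0 ∨ oddPart d l + 1 < e'
  · exact Or.inl ⟨h1, h2⟩
  · have := h 0 (by omega)
    rw [cycleVertex, cycleVertex, if_pos h1, if_neg h2] at this
    exact absurd this (cInf_ne_odoPoint _ _)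
  · have := h 0 (by omega)
    rw [cycleVertex, cycleVertex, if_neg h1, if_pos h2] at this
    exact absurd this.symm (cInf_ne_odoPoint _ _)
  · rw [cycleVertex, cycleVertex, if_neg h1, if_neg h2, hd.agree_odoPoint_iff,
      hd.radixProd_succ_eq] at h
    have := oddPart_pos d l
    have := Nat.ModEq.eq_of_lt_of_lt h (by omega) (by omega)
    omega

/-- The word is an endpoint of an arc. -/
def IsEndpoint (d : ℕ → ℕ) (w : InfWord) : Prop :=
  ∃ l e, IsArcIndex d l e ∧ (w = arcSource d l e ∨ w = arcTarget d l e)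

theorem isEndpoint_arcSource {e : ℕ} (he : IsArcIndex d l e) : IsEndpoint d (arcSource d l e) :=
  ⟨l, e, he, Or.inl rfl⟩

theorem isEndpoint_arcTarget {e : ℕ} (he : IsArcIndex d l e) : IsEndpoint d (arcTarget d l e) :=
  ⟨l, e, he, Or.inr rfl⟩

/-- The level of an endpoint is read off from the position of its first letter a or ā. -/
theorem level_eq_of_agree {l l' : ℕ} {x y : InfWord} (hx : ∀ j ≤ l, (x j).IsPlain)
    (hx' : ¬ (x (l + 1)).IsPlain) (hy : ∀ j ≤ l', (y j).IsPlain) (hy' : ¬ (y (l' + 1)).IsPlain)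
    (h : Agree (l + 2) x y) : l = l' := by
  rcases lt_trichotomy l l' with h1 | h1 | h1
  · exact absurd (h (l + 1) (by omega) ▸ hy (l + 1) (by omega)) hx'
  · exact h1
  · exact absurd (h (l' + 1) (by omega) ▸ hx (l' + 1) (by omega)) hy'

theorem isPlain_arcSource {e j : ℕ} (hj : j ≤ l) : (arcSource d l e j).IsPlain := by
  rw [agree_arcSource e j (by omega)]
  exact isPlain_cycleVertex _ _

theorem isPlain_arcTarget {e j : ℕ} (hj : j ≤ l) : (arcTarget d l e j).IsPlain := by
  rw [agree_arcTarget e j (by omega)]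
  exact isPlain_cycleVertex _ _

theorem not_isPlain_arcSource (e : ℕ) : ¬ (arcSource d l e (l + 1)).IsPlain := by
  rw [arcSource_marker]
  exact fun h => h.1 rfl

theorem not_isPlain_arcTarget (e : ℕ) : ¬ (arcTarget d l e (l + 1)).IsPlain := by
  rw [arcTarget_marker]
  exact fun h => h.2 rfl

theorem arcSource_inj_of_agree (hd : IsOdometerSeq d) {l' e e' : ℕ} (he : IsArcIndex d l e)
    (he' : IsArcIndex d l' e') (h : Agree (l + 2) (arcSource d l e) (arcSource d l' e')) :
    l = l' ∧ e = e' := by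
  obtain rfl : l = l' := level_eq_of_agree (fun _ => isPlain_arcSource) (not_isPlain_arcSource e)
    (fun _ => isPlain_arcSource) (not_isPlain_arcSource e') h
  have := cycleVertex_eq_of_agree hd
    (((agree_arcSource e).symm.trans (h.mono (by omega))).trans (agree_arcSource e'))
  -- An arc index is at most P_l + 1, so c^∞ occurs at a source only for e = 0.
  unfold IsArcIndex at he he'
  exact ⟨rfl, by omega⟩

theorem arcTarget_inj_of_agree (hd : IsOdometerSeq d) {l' e e' : ℕ} (he : IsArcIndex d l e)
    (he' : IsArcIndex d l' e') (h : Agree (l + 2) (arcTarget d l e) (arcTarget d l' e')) :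
    l = l' ∧ e = e' := by
  obtain rfl : l = l' := level_eq_of_agree (fun _ => isPlain_arcTarget) (not_isPlain_arcTarget e)
    (fun _ => isPlain_arcTarget) (not_isPlain_arcTarget e') h
  have := cycleVertex_eq_of_agree hd
    (((agree_arcTarget e).symm.trans (h.mono (by omega))).trans (agree_arcTarget e'))
  unfold IsArcIndex at he he'
  exact ⟨rfl, by omega⟩

theorem not_agree_arcSource_arcTarget {l' e e' : ℕ} :
    ¬ Agree (l + 2) (arcSource d l e) (arcTarget d l' e') := by
  intro h
  obtain rfl : l = l' := level_eq_of_agree (fun _ => isPlain_arcSource) (not_isPlain_arcSource e)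
    (fun _ => isPlain_arcTarget) (not_isPlain_arcTarget e') h
  have := h (l + 1) (by omega)
  rw [arcSource_marker, arcTarget_marker] at this
  cases this

theorem not_agree_arcTarget_arcSource {l' e e' : ℕ} :
    ¬ Agree (l + 2) (arcTarget d l e) (arcSource d l' e') := by
  intro h
  obtain rfl : l = l' := level_eq_of_agree (fun _ => isPlain_arcTarget) (not_isPlain_arcTarget e)
    (fun _ => isPlain_arcSource) (not_isPlain_arcSource e') h
  have := h (l + 1) (by omega)
  rw [arcSource_marker, arcTarget_marker] at this
  cases this

end cycleVertex

/-! ### The space of vertices -/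

section odoSpace

variable {d : ℕ → ℕ}

theorem odoSpace_eq (d : ℕ → ℕ) : odoSpace d = closure {w | IsEndpoint d w} := by
  unfold odoSpace
  congr 1
  ext x
  simp only [Set.mem_ofPred_eq, odoArc_iff, IsEndpoint]
  constructor
  · rintro ⟨y, ⟨l, e, he, h, -⟩ | ⟨l, e, he, -, h⟩⟩
    · exact ⟨l, e, he, Or.inl h⟩
    · exact ⟨l, e, he, Or.inr h⟩
  · rintro ⟨l, e, he, h | h⟩
    · exact ⟨_, Or.inl ⟨l, e, he, h, rfl⟩⟩
    · exact ⟨_, Or.inr ⟨l, e, he, rfl, h⟩⟩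

theorem mem_odoSpace_iff {w : InfWord} : w ∈ odoSpace d ↔ ∀ n, ∃ x, IsEndpoint d x ∧ Agree n w x := by
  rw [odoSpace_eq, mem_closure_iff_agree]
  rfl

theorem IsEndpoint.mem {w : InfWord} (h : IsEndpoint d w) : w ∈ odoSpace d :=
  mem_odoSpace_iff.2 fun n => ⟨w, h, Agree.refl n w⟩

/-- The l + 2 letters reach the first letter of the marker, hence determine the endpoint; as
endpoints are dense, this makes the source isolated in the whole space. -/
theorem eq_arcSource_of_agree (hd : IsOdometerSeq d) {w : InfWord} (hw : w ∈ odoSpace d) {l e : ℕ}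
    (he : IsArcIndex d l e) (h : Agree (l + 2) (arcSource d l e) w) : w = arcSource d l e := by
  refine eq_of_forall_agree fun n => ?_
  obtain ⟨x, ⟨l', e', he', rfl | rfl⟩, hx⟩ := mem_odoSpace_iff.1 hw (max n (l + 2))
  · obtain ⟨rfl, rfl⟩ := arcSource_inj_of_agree hd he he' (h.trans (hx.mono (le_max_right _ _)))
    exact hx.mono (le_max_left _ _)
  · exact absurd (h.trans (hx.mono (le_max_right _ _))) not_agree_arcSource_arcTarget

theorem eq_arcTarget_of_agree (hd : IsOdometerSeq d) {w : InfWord} (hw : w ∈ odoSpace d) {l e : ℕ}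
    (he : IsArcIndex d l e) (h : Agree (l + 2) (arcTarget d l e) w) : w = arcTarget d l e := by
  refine eq_of_forall_agree fun n => ?_
  obtain ⟨x, ⟨l', e', he', rfl | rfl⟩, hx⟩ := mem_odoSpace_iff.1 hw (max n (l + 2))
  · exact absurd (h.trans (hx.mono (le_max_right _ _))) not_agree_arcTarget_arcSource
  · obtain ⟨rfl, rfl⟩ := arcTarget_inj_of_agree hd he he' (h.trans (hx.mono (le_max_right _ _)))
    exact hx.mono (le_max_left _ _)

theorem IsEndpoint.exists_isolated (hd : IsOdometerSeq d) {w : InfWord} (h : IsEndpoint d w) :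
    ∃ n, ∀ w' ∈ odoSpace d, Agree n w w' → w' = w := by
  obtain ⟨l, e, he, rfl | rfl⟩ := h
  · exact ⟨l + 2, fun w' hw' => eq_arcSource_of_agree hd hw' he⟩
  · exact ⟨l + 2, fun w' hw' => eq_arcTarget_of_agree hd hw' he⟩

/-- The points of the odometer. -/
def IsOdoLimit (d : ℕ → ℕ) (w : InfWord) : Prop := ∀ n, ∃ i, Agree n w (odoPoint d i)

theorem IsOdoLimit.isPlain {w : InfWord} (h : IsOdoLimit d w) (n : ℕ) : (w n).IsPlain := by
  obtain ⟨i, hi⟩ := h (n + 1)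
  rw [hi n (by omega)]
  exact isPlain_odoPoint i n

theorem IsEndpoint.exists_not_isPlain {w : InfWord} (h : IsEndpoint d w) :
    ∃ n, ¬ (w n).IsPlain := by
  obtain ⟨l, e, he, rfl | rfl⟩ := h
  · exact ⟨_, not_isPlain_arcSource e⟩
  · exact ⟨_, not_isPlain_arcTarget e⟩

theorem not_isEndpoint_cInf : ¬ IsEndpoint d cInf :=
  fun h => let ⟨n, hn⟩ := h.exists_not_isPlain; hn (isPlain_cInf n)

theorem IsOdoLimit.not_isEndpoint {w : InfWord} (h : IsOdoLimit d w) : ¬ IsEndpoint d w :=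
  fun h' => let ⟨n, hn⟩ := h'.exists_not_isPlain; hn (h.isPlain n)

/-- An endpoint whose first `n + 1` letters are plain has level at least `n`. -/
theorem le_level_of_isPlain {l e n : ℕ} {w x : InfWord}
    (hx : x = arcSource d l e ∨ x = arcTarget d l e)
    (h : Agree (n + 1) w x) (hw : ∀ j ≤ n, (w j).IsPlain) : n ≤ l := by
  by_contra! hc
  have hp := hw (l + 1) (by omega)
  rw [h (l + 1) (by omega)] at hp
  rcases hx with rfl | rfl
  · exact not_isPlain_arcSource e hp
  · exact not_isPlain_arcTarget e hp

theorem cycleVertex_eq_or (d : ℕ → ℕ) (l e : ℕ) :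
    cycleVertex d l e = cInf ∨ ∃ i, cycleVertex d l e = odoPoint d i := by
  unfold cycleVertex
  split_ifs
  · exact Or.inl rfl
  · exact Or.inr ⟨_, rfl⟩

theorem mem_odoSpace_cases (hd : IsOdometerSeq d) {w : InfWord} (hw : w ∈ odoSpace d) :
    IsEndpoint d w ∨ w = cInf ∨ IsOdoLimit d w := by
  by_cases hp : ∀ n, (w n).IsPlain
  · right
    -- Endpoints close to a word without marker have large level, so their own prefixes come from
    -- vertices of the cycle.
    have key : ∀ n, ∃ v, (v = cInf ∨ ∃ i, v = odoPoint d i) ∧ Agree (n + 1) w v := by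
      intro n
      obtain ⟨x, ⟨l, e, he, hx⟩, hwx⟩ := mem_odoSpace_iff.1 hw (n + 1)
      have hl := le_level_of_isPlain hx hwx fun j _ => hp j
      rcases hx with rfl | rfl
      · exact ⟨_, cycleVertex_eq_or d l e, hwx.trans ((agree_arcSource e).mono (by omega))⟩
      · exact ⟨_, cycleVertex_eq_or d l (e + 1), hwx.trans ((agree_arcTarget e).mono (by omega))⟩
    by_cases h0 : w 0 = Letter.c
    · left
      refine eq_of_forall_agree fun n => ?_
      obtain ⟨v, rfl | ⟨i, rfl⟩, hv⟩ := key n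
      · exact hv.mono (by omega)
      · have := hv 0 (by omega)
        rw [h0] at this
        simp [odoPoint] at this
    · right
      intro n
      obtain ⟨v, rfl | ⟨i, rfl⟩, hv⟩ := key n
      · exact absurd (hv 0 (by omega)) h0
      · exact ⟨i, hv.mono (by omega)⟩
  · left
    push Not at hp
    obtain ⟨p, hp⟩ := hp
    obtain ⟨x, hx, hwx⟩ := mem_odoSpace_iff.1 hw (p + 1)
    have main : ∀ {l e}, (x = arcSource d l e ∨ x = arcTarget d l e) → l + 1 ≤ p := by
      intro l e hx
      by_contra! hc
      rw [hwx p (by omega)] at hp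
      rcases hx with rfl | rfl
      · exact hp (isPlain_arcSource (by omega))
      · exact hp (isPlain_arcTarget (by omega))
    obtain ⟨l, e, he, hx'⟩ := hx
    have hl := main hx'
    rcases hx' with rfl | rfl
    · rw [eq_arcSource_of_agree hd hw he (hwx.symm.mono (by omega))]
      exact isEndpoint_arcSource he
    · rw [eq_arcTarget_of_agree hd hw he (hwx.symm.mono (by omega))]
      exact isEndpoint_arcTarget he

theorem cInf_mem (d : ℕ → ℕ) : cInf ∈ odoSpace d := by
  refine mem_odoSpace_iff.2 fun n => ⟨_, isEndpoint_arcSource (l := n) (Nat.zero_le _), ?_⟩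
  have := agree_arcSource (d := d) (l := n) 0
  rw [cycleVertex_zero] at this
  exact this.symm.mono (by omega)

theorem odoPoint_mem (hd : IsOdometerSeq d) (i : ℕ) : odoPoint d i ∈ odoSpace d := by
  refine mem_odoSpace_iff.2 fun n => ?_
  have hi : i ≤ oddPart d (n + i) := by have := hd.lt_oddPart (n + i); omega
  refine ⟨_, isEndpoint_arcSource (l := n + i) (e := i + 1) (Nat.succ_le_succ hi), ?_⟩
  have := agree_arcSource (d := d) (l := n + i) (i + 1)
  rw [cycleVertex_succ hi] at this
  exact this.symm.mono (by omega)

theorem cycleVertex_mem (hd : IsOdometerSeq d) (l e : ℕ) : cycleVertex d l e ∈ odoSpace d := by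
  rcases cycleVertex_eq_or d l e with h | ⟨i, h⟩ <;> rw [h]
  · exact cInf_mem d
  · exact odoPoint_mem hd i

end odoSpace

/-! ### Chromatic numbers -/

namespace TopGraph

theorem chromaticNumber_le (X : TopGraph.{u}) {Γ : Set (Set X.carrier)} {κ : Cardinal.{0}}
    (h : κ ∈ X.colorCardinals Γ) : X.chromaticNumber Γ ≤ κ := by
  rw [chromaticNumber, if_pos ⟨κ, h⟩]
  exact csInf_le' h

theorem le_chromaticNumber (X : TopGraph.{u}) {Γ : Set (Set X.carrier)} {κ : Cardinal.{0}}
    (hκ : κ ≤ 𝔠) (h : ∀ μ ∈ X.colorCardinals Γ, κ ≤ μ) : κ ≤ X.chromaticNumber Γ := by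
  unfold chromaticNumber
  split_ifs with hne
  · exact le_csInf hne h
  · exact hκ

theorem le_natCast_of_not_succ_le {κ : Cardinal.{0}} {n : ℕ} (h : ¬ ((n + 1 : ℕ) : Cardinal) ≤ κ) :
    κ ≤ n := by
  rw [not_le] at h
  obtain ⟨m, rfl⟩ := Cardinal.lt_aleph0.1 (h.trans Cardinal.natCast_lt_aleph0)
  have := Nat.cast_lt.1 h
  exact Nat.cast_le.2 (by omega)

/-- At most two colors embed into `Bool`; this is the only form in which the lower bound is used. -/
theorem three_le_ccn_iff (X : TopGraph.{u}) :
    3 ≤ X.ccn ↔ ¬ ∃ f : X.carrier → Bool, Continuous f ∧ ∀ x y, X.graph.Adj x y → f x ≠ f y := by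
  constructor
  · rintro h ⟨f, hf, hf'⟩
    have h2 : (2 : Cardinal.{0}) ∈ X.colorCardinals {s | IsOpen s} :=
      ⟨(Cardinal.natCast_lt_aleph0 (n := 2)).le, Bool, by simp, f,
        fun A => (isOpen_discrete A).preimage hf, hf'⟩
    have : (3 : Cardinal.{0}) ≤ 2 := h.trans (X.chromaticNumber_le h2)
    have : ((3 : ℕ) : Cardinal.{0}) ≤ ((2 : ℕ) : Cardinal.{0}) := by exact_mod_cast this
    exact absurd (Nat.cast_le.1 this) (by decide)
  · intro h
    refine X.le_chromaticNumber ((Cardinal.natCast_lt_aleph0 (n := 3)).le.trans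
      Cardinal.aleph0_le_continuum) ?_
    rintro κ ⟨-, C, rfl, f, hf, hf'⟩
    by_contra hc
    have h2 : #C ≤ #Bool := by
      rw [Cardinal.mk_bool]
      exact le_natCast_of_not_succ_le (n := 2) (by exact_mod_cast hc)
    obtain ⟨g⟩ := (Cardinal.le_def _ _).1 h2
    refine h ⟨g ∘ f, ⟨fun A _ => ?_⟩, fun x y hxy => g.injective.ne (hf' x y hxy)⟩
    rw [Set.preimage_comp]
    exact hf _

theorem ContLE.three_le_ccn {X : TopGraph.{u}} {Y : TopGraph.{v}} (h : X.ContLE Y)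
    (hX : 3 ≤ X.ccn) : 3 ≤ Y.ccn := by
  rw [three_le_ccn_iff] at hX ⊢
  rintro ⟨f, hf, hf'⟩
  obtain ⟨φ, hφ, hφ'⟩ := h
  exact hX ⟨f ∘ φ, hf.comp hφ, fun x y hxy => hf' _ _ (hφ' x y hxy)⟩

theorem InjContLE.contLE {X : TopGraph.{u}} {Y : TopGraph.{v}} (h : X.InjContLE Y) : X.ContLE Y :=
  let ⟨φ, _, hφ⟩ := h
  ⟨φ, hφ⟩

end TopGraph

/-! ### The topology of the space of vertices -/

section

variable {d : ℕ → ℕ}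

theorem isClosed_odoSpace (d : ℕ → ℕ) : IsClosed (odoSpace d) := isClosed_closure

/-- The alphabet is infinite, but only c, a, ā and the digits below d_j occur at the coordinate j,
so the space is closed in a product of finite sets. -/
theorem isCompact_odoSpace (hd : IsOdometerSeq d) : IsCompact (odoSpace d) := by
  let F : ℕ → Set Letter := fun j => {.c, .a, .abar} ∪ Letter.num '' Set.Iio (d j)
  have hF : ∀ j, (F j).Finite := fun j => (Set.toFinite _).union ((Set.finite_Iio _).image _)
  have hcv : ∀ l e j, cycleVertex d l e j ∈ F j := by
    intro l e j
    rcases cycleVertex_eq_or d l e with h | ⟨i, h⟩ <;> rw [h]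
    · exact Or.inl (Or.inl rfl)
    · rw [hd.odoPoint_apply]
      have := hd.two_le j
      exact Or.inr ⟨_, Nat.mod_lt _ (by omega), rfl⟩
  have hE : ∀ w, IsEndpoint d w → ∀ j, w j ∈ F j := by
    rintro w ⟨l, e, he, rfl | rfl⟩ j
    · unfold arcSource wordA
      split_ifs
      · exact hcv _ _ _
      · exact Or.inl (Or.inr (Or.inl rfl))
      · exact Or.inl (Or.inr (Or.inr rfl))
    · unfold arcTarget wordAbar
      split_ifs
      · exact hcv _ _ _
      · exact Or.inl (Or.inr (Or.inr rfl))
      · exact Or.inl (Or.inr (Or.inl rfl))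
  refine (isCompact_univ_pi fun j => (hF j).isCompact).of_isClosed_subset (isClosed_odoSpace d) ?_
  intro w hw j _
  obtain ⟨x, hx, hwx⟩ := mem_odoSpace_iff.1 hw (j + 1)
  rw [hwx j (by omega)]
  exact hE x hx j

instance : Countable Letter := by
  have : Function.Injective (fun x : Letter => match x with
    | .num n => n + 3
    | .c => 0
    | .a => 1
    | .abar => 2) := by
    intro x y h
    cases x <;> cases y <;> simp_all
  exact this.countable

theorem isZeroDimMetrizableCompact_odoTopGraph (hd : IsOdometerSeq d) :
    (odoTopGraph d).IsZeroDimMetrizableCompact := by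
  have : CompactSpace (odoSpace d) := isCompact_iff_compactSpace.1 (isCompact_odoSpace hd)
  have h2 : TopologicalSpace.MetrizableSpace (odoSpace d) := inferInstance
  have h1 : TopologicalSpace.IsTopologicalBasis {s : Set (odoSpace d) | IsClopen s} :=
    loc_compact_Haus_tot_disc_of_zero_dim
  exact ⟨h1, h2, this⟩

/-- An equivalence relation with open classes on the space of vertices is determined by prefixes
of a fixed length. -/
theorem exists_uniform_prefix (hd : IsOdometerSeq d) {r : odoSpace d → odoSpace d → Prop}
    (hsymm : ∀ x y, r x y → r y x) (htrans : ∀ x y z, r x y → r y z → r x z)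
    (h : ∀ x : odoSpace d, ∃ n, ∀ y : odoSpace d, Agree n x.1 y.1 → r x y) :
    ∃ n, ∀ x y : odoSpace d, Agree n x.1 y.1 → r x y := by
  have : CompactSpace (odoSpace d) := isCompact_iff_compactSpace.1 (isCompact_odoSpace hd)
  choose n hn using h
  obtain ⟨t, -, ht⟩ := (isCompact_univ (X := odoSpace d)).elim_nhds_subcover
    (fun x => {y | Agree (n x) x.1 y.1}) fun x _ =>
      ((isOpen_setOf_agree (n x) x.1).preimage continuous_subtype_val).mem_nhds (Agree.refl _ _)
  refine ⟨t.sup n, fun x y hxy => ?_⟩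
  obtain ⟨z, hz, hzx⟩ := Set.mem_iUnion₂.1 (ht (Set.mem_univ x))
  have hzx : Agree (n z) z.1 x.1 := hzx
  exact htrans _ z _ (hsymm _ _ (hn z x hzx)) (hn z y (hzx.trans (hxy.mono (Finset.le_sup hz))))

theorem exists_uniform_prefix_of_discrete (hd : IsOdometerSeq d) {Z : Type*} [TopologicalSpace Z]
    [DiscreteTopology Z] {f : odoSpace d → Z} (hf : Continuous f) :
    ∃ n, ∀ x y : odoSpace d, Agree n x.1 y.1 → f x = f y := by
  refine exists_uniform_prefix hd (fun _ _ => Eq.symm) (fun _ _ _ => Eq.trans) fun x => ?_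
  obtain ⟨U, hU, hU'⟩ := isOpen_induced_iff.1 ((isOpen_discrete {f x}).preimage hf)
  have hx : x ∈ Subtype.val ⁻¹' U := by
    rw [hU']
    rfl
  obtain ⟨n, hn⟩ := exists_agree_subset hU hx
  refine ⟨n, fun y hy => ?_⟩
  have : y ∈ Subtype.val ⁻¹' U := hn _ hy
  rw [hU'] at this
  exact Eq.symm this

theorem exists_uniform_prefix_of_continuous (hd : IsOdometerSeq d) {f : odoSpace d → InfWord}
    (hf : Continuous f) (m : ℕ) :
    ∃ n, ∀ x y : odoSpace d, Agree n x.1 y.1 → Agree m (f x) (f y) :=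
  exists_uniform_prefix hd (fun _ _ => Agree.symm) (fun _ _ _ => Agree.trans) fun x =>
    continuous_subtype_iff_agree.1 hf x m

theorem isOpen_singleton_of_isEndpoint (hd : IsOdometerSeq d) {x : odoSpace d}
    (hx : IsEndpoint d x.1) : IsOpen {x} := by
  obtain ⟨n, hn⟩ := hx.exists_isolated hd
  have : {x} = Subtype.val ⁻¹' {y : InfWord | Agree n x.1 y} := by
    ext y
    constructor
    · rintro rfl
      exact Agree.refl _ _
    · exact fun hy => Subtype.ext (hn y.1 y.2 hy)
  rw [this]
  exact (isOpen_setOf_agree n x.1).preimage continuous_subtype_val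

theorem isOpen_of_forall_isEndpoint (hd : IsOdometerSeq d) {S : Set (odoSpace d)}
    (hS : ∀ x ∈ S, IsEndpoint d x.1) : IsOpen S := by
  rw [← Set.biUnion_of_singleton S]
  exact isOpen_biUnion fun x hx => isOpen_singleton_of_isEndpoint hd (hS x hx)

/-! ### Elementary properties of the graph -/

/-- The symmetrization of the oriented graph. -/
def OdoEdge (d : ℕ → ℕ) (x y : InfWord) : Prop := OdoArc d x y ∨ OdoArc d y x

theorem OdoEdge.symm {x y : InfWord} (h : OdoEdge d x y) : OdoEdge d y x := Or.symm h

theorem arcSource_inj (hd : IsOdometerSeq d) {l e l' e' : ℕ} (he : IsArcIndex d l e)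
    (he' : IsArcIndex d l' e') (h : arcSource d l e = arcSource d l' e') : l = l' ∧ e = e' :=
  arcSource_inj_of_agree hd he he' (h ▸ Agree.refl _ _)

theorem arcTarget_inj (hd : IsOdometerSeq d) {l e l' e' : ℕ} (he : IsArcIndex d l e)
    (he' : IsArcIndex d l' e') (h : arcTarget d l e = arcTarget d l' e') : l = l' ∧ e = e' :=
  arcTarget_inj_of_agree hd he he' (h ▸ Agree.refl _ _)

theorem arcSource_ne_arcTarget (d : ℕ → ℕ) (l e l' e' : ℕ) : arcSource d l e ≠ arcTarget d l' e' :=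
  fun h => not_agree_arcSource_arcTarget (d := d) (l := l) (e := e) (e' := e') (l' := l')
    (h ▸ Agree.refl _ _)

theorem OdoEdge.unique (hd : IsOdometerSeq d) {x y z : InfWord} (h : OdoEdge d x y)
    (h' : OdoEdge d x z) : y = z := by
  rcases h with h | h <;> rcases h' with h' | h' <;> rw [odoArc_iff] at h h' <;>
    obtain ⟨l, e, he, h1, h2⟩ := h <;> obtain ⟨l', e', he', h1', h2'⟩ := h'
  · obtain ⟨rfl, rfl⟩ := arcSource_inj hd he he' (h1.symm.trans h1')
    rw [h2, h2']
  · exact absurd (h1.symm.trans h2') (arcSource_ne_arcTarget _ _ _ _ _)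
  · exact absurd (h1'.symm.trans h2) (arcSource_ne_arcTarget _ _ _ _ _)
  · obtain ⟨rfl, rfl⟩ := arcTarget_inj hd he he' (h2.symm.trans h2')
    rw [h1, h1']

theorem OdoEdge.isEndpoint {x y : InfWord} (h : OdoEdge d x y) : IsEndpoint d x := by
  rcases h with h | h <;> obtain ⟨l, e, he, rfl, rfl⟩ := odoArc_iff.1 h
  · exact isEndpoint_arcSource he
  · exact isEndpoint_arcTarget he

theorem degreeLEOne_odoTopGraph (hd : IsOdometerSeq d) : (odoTopGraph d).DegreeLEOne := by
  intro x
  rw [Set.encard_le_one_iff]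
  exact fun y z hy hz => Subtype.ext (OdoEdge.unique hd hy hz)

theorem countable_setOf_isEndpoint (d : ℕ → ℕ) : {w | IsEndpoint d w}.Countable := by
  refine ((Set.countable_range fun p : ℕ × ℕ => arcSource d p.1 p.2).union
    (Set.countable_range fun p : ℕ × ℕ => arcTarget d p.1 p.2)).mono ?_
  rintro w ⟨l, e, -, h | h⟩
  · exact Or.inl ⟨(l, e), h.symm⟩
  · exact Or.inr ⟨(l, e), h.symm⟩

theorem countable_edges_odoTopGraph (d : ℕ → ℕ) : (odoTopGraph d).edges.Countable := by
  have h : (Subtype.val ⁻¹' {w | IsEndpoint d w} : Set (odoSpace d)).Countable :=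
    (countable_setOf_isEndpoint d).preimage Subtype.val_injective
  refine (h.prod h).mono fun p hp => ?_
  have hp : OdoEdge d p.1.1 p.2.1 := hp
  exact ⟨hp.isEndpoint, hp.symm.isEndpoint⟩

/-- Both endpoints of an edge are isolated. This is more than is needed for a difference of two
closed sets. -/
theorem isOpen_edges_odoTopGraph (hd : IsOdometerSeq d) : IsOpen (odoTopGraph d).edges := by
  rw [← Set.biUnion_of_singleton (odoTopGraph d).edges]
  refine isOpen_biUnion fun p hp => ?_
  rw [← Prod.mk.eta (p := p), ← Set.singleton_prod_singleton]
  exact (isOpen_singleton_of_isEndpoint hd (OdoEdge.isEndpoint hp)).prod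
    (isOpen_singleton_of_isEndpoint hd (OdoEdge.isEndpoint (OdoEdge.symm hp)))

theorem edges_odoTopGraph_mem_D2Closed (hd : IsOdometerSeq d) :
    (odoTopGraph d).edges ∈ D2Closed ((odoTopGraph d).carrier × (odoTopGraph d).carrier) :=
  ⟨Set.univ, (odoTopGraph d).edgesᶜ, isClosed_univ, (isOpen_edges_odoTopGraph hd).isClosed_compl,
    by simp⟩

/-- There is no two-coloring of the odd cycle of the level `l`. -/
theorem not_forall_ne_succ_of_cycle {l : ℕ} {F : ℕ → Bool} (h0 : F (oddPart d l + 2) = F 0) :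
    ¬ ∀ e, IsArcIndex d l e → F e ≠ F (e + 1) := by
  intro h
  have key : ∀ e ≤ oddPart d l + 2, F e = (F 0 ^^ decide (Odd e)) := by
    intro e
    induction e with
    | zero => simp
    | succ e ih =>
      intro he
      have h1 := h e (by unfold IsArcIndex; omega)
      rw [ih (by omega)] at h1
      simp only [Nat.odd_add_one]
      generalize F 0 = b at *
      generalize F (e + 1) = b' at *
      by_cases ho : Odd e <;> cases b <;> cases b' <;> simp_all
  have h1 := key _ le_rfl
  have hodd : Odd (oddPart d l + 2) := by
    obtain ⟨t, ht⟩ := oddPart_odd d l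
    exact ⟨t + 1, by omega⟩
  rw [h0] at h1
  cases h : F 0 <;> simp [h, hodd] at h1

theorem three_le_ccn_odoTopGraph (hd : IsOdometerSeq d) : 3 ≤ (odoTopGraph d).ccn := by
  rw [TopGraph.three_le_ccn_iff]
  intro h
  obtain ⟨f, hf, hf'⟩ : ∃ f : odoSpace d → Bool, Continuous f ∧
    ∀ x y : odoSpace d, OdoEdge d x.1 y.1 → f x ≠ f y := h
  obtain ⟨k, hk⟩ := exists_uniform_prefix_of_discrete hd (f := f) hf
  -- The endpoints of level k share k + 1 letters with the vertices of the cycle, so the coloring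
  -- transfers to this odd cycle.
  refine not_forall_ne_succ_of_cycle (d := d) (l := k)
    (F := fun e => f ⟨cycleVertex d k e, cycleVertex_mem hd k e⟩) (by simp) fun e he => ?_
  rw [hk ⟨cycleVertex d k e, _⟩ ⟨_, (isEndpoint_arcSource he).mem⟩
      ((agree_arcSource e).symm.mono (by omega)),
    hk ⟨cycleVertex d k (e + 1), _⟩ ⟨_, (isEndpoint_arcTarget he).mem⟩
      ((agree_arcTarget e).symm.mono (by omega))]
  exact hf' _ _ (Or.inl (odoArc_arc he))

/-- The coloring of the letters that gives a three-coloring of the graph. -/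
def Letter.color : Letter → Fin 3
  | .num 0 => 0
  | .num _ => 1
  | _ => 2

theorem IsOdometerSeq.odoPoint_zero_eq (hd : IsOdometerSeq d) (i : ℕ) :
    odoPoint d i 0 = Letter.num (i % 2) := by
  rw [hd.odoPoint_apply, radixProd_zero, Nat.div_one, hd.1]

/-- The first digit is the parity of the exponent because d_0 = 2, so it alternates along the orbit,
while c keeps a third color. -/
theorem IsOdometerSeq.color_cycleVertex_ne (hd : IsOdometerSeq d) {l e : ℕ}
    (he : IsArcIndex d l e) :
    (cycleVertex d l e 0).color ≠ (cycleVertex d l (e + 1) 0).color := by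
  rcases he.cases with rfl | ⟨i, hi, rfl⟩ | rfl
  · rw [cycleVertex_zero, cycleVertex_succ (Nat.zero_le _), hd.odoPoint_zero_eq]
    decide
  · rw [cycleVertex_succ hi.le, cycleVertex_succ hi, hd.odoPoint_zero_eq, hd.odoPoint_zero_eq]
    rcases Nat.mod_two_eq_zero_or_one i with h | h
    · have : (i + 1) % 2 = 1 := by omega
      rw [h, this]
      decide
    · have : (i + 1) % 2 = 0 := by omega
      rw [h, this]
      decide
  · rw [cycleVertex_last, cycleVertex_succ le_rfl, hd.odoPoint_zero_eq,
      Nat.odd_iff.1 (oddPart_odd d l)]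
    decide

theorem ccn_odoTopGraph (hd : IsOdometerSeq d) : (odoTopGraph d).ccn = 3 := by
  refine le_antisymm ((odoTopGraph d).chromaticNumber_le ?_) (three_le_ccn_odoTopGraph hd)
  have main : ∀ x y, OdoArc d x y → (x 0).color ≠ (y 0).color := by
    intro x y h
    obtain ⟨l, e, he, rfl, rfl⟩ := odoArc_iff.1 h
    rw [agree_arcSource e 0 (by omega), agree_arcTarget e 0 (by omega)]
    exact hd.color_cycleVertex_ne he
  refine ⟨(Cardinal.natCast_lt_aleph0 (n := 3)).le, Fin 3, by simp,
    fun x => (x.1 0).color, fun A => ?_, ?_⟩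
  · exact (isOpen_discrete (Letter.color ⁻¹' A)).preimage
      ((continuous_apply (A := fun _ : ℕ => Letter) 0).comp continuous_subtype_val)
  · rintro x y (h | h)
    · exact main _ _ h
    · exact (main _ _ h).symm

theorem chromaticNumber_openPlusClosed_odoTopGraph (hd : IsOdometerSeq d) :
    (odoTopGraph d).chromaticNumber (OpenPlusClosed (odoTopGraph d).carrier) = 2 := by
  classical
  refine le_antisymm ((odoTopGraph d).chromaticNumber_le ?_)
    ((odoTopGraph d).le_chromaticNumber ((Cardinal.natCast_lt_aleph0 (n := 2)).le.trans
      Cardinal.aleph0_le_continuum) ?_)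
  · let S : Set (odoSpace d) := {x | ∃ l e, IsArcIndex d l e ∧ x.1 = arcSource d l e}
    have hS : IsOpen S := isOpen_of_forall_isEndpoint hd fun x hx =>
      let ⟨l, e, he, h⟩ := hx
      ⟨l, e, he, Or.inl h⟩
    have main : ∀ x y : odoSpace d, OdoArc d x.1 y.1 → x ∈ S ∧ y ∉ S := by
      intro x y h
      obtain ⟨l, e, he, hx, hy⟩ := odoArc_iff.1 h
      refine ⟨⟨l, e, he, hx⟩, ?_⟩
      rintro ⟨l', e', -, hy'⟩
      exact arcSource_ne_arcTarget _ _ _ _ _ (hy'.symm.trans hy)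
    have hpre : ∀ A : Set Bool,
        (fun x : odoSpace d => decide (x ∈ S)) ⁻¹' A ∈ OpenPlusClosed (odoSpace d) := by
      intro A
      -- The set of sources is open but need not be closed, so the clopen set is chosen trivial:
      -- everything when the preimage is open, empty when the preimage is closed.
      by_cases ht : true ∈ A
      · refine ⟨Set.univ, if false ∈ A then Set.univ else S, ∅, isClopen_univ, ?_,
          isClosed_empty, ?_⟩
        · split_ifs
          exacts [isOpen_univ, hS]
        · ext x
          by_cases hx : x ∈ S <;> by_cases hf : false ∈ A <;> simp [hx, hf, ht]
      · refine ⟨∅, ∅, if false ∈ A then Sᶜ else ∅, isClopen_empty, isOpen_empty, ?_, ?_⟩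
        · split_ifs
          exacts [hS.isClosed_compl, isClosed_empty]
        · ext x
          by_cases hx : x ∈ S <;> by_cases hf : false ∈ A <;> simp [hx, hf, ht]
    have hne : ∀ x y : odoSpace d, OdoEdge d x.1 y.1 → decide (x ∈ S) ≠ decide (y ∈ S) := by
      rintro x y (h | h)
      · simp [(main _ _ h).1, (main _ _ h).2]
      · simp [(main _ _ h).1, (main _ _ h).2]
    exact ⟨(Cardinal.natCast_lt_aleph0 (n := 2)).le, Bool, by simp, _, hpre, hne⟩
  · rintro κ ⟨-, C, rfl, f, -, hf⟩
    by_contra hc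
    have h1 : #C ≤ 1 := by
      have := TopGraph.le_natCast_of_not_succ_le (n := 1) (κ := #C) (by exact_mod_cast hc)
      exact_mod_cast this
    have := Cardinal.le_one_iff_subsingleton.1 h1
    have he : IsArcIndex d 0 0 := Nat.zero_le _
    exact hf ⟨_, (isEndpoint_arcSource he).mem⟩ ⟨_, (isEndpoint_arcTarget he).mem⟩
      (Or.inl (odoArc_arc he)) (Subsingleton.elim _ _)

end

/-! ### Minimality -/

section

variable {d : ℕ → ℕ}

theorem continuous_of_forall_agree {S : Set InfWord} {Z : Type*} [TopologicalSpace Z] {f : S → Z}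
    (h : ∀ x : S, ∃ n, ∀ y : S, Agree n x.1 y.1 → f x = f y) : Continuous f := by
  refine continuous_iff_continuousAt.2 fun x => ?_
  obtain ⟨n, hn⟩ := h x
  have hnx : {y : S | Agree n x.1 y.1} ∈ nhds x :=
    ((isOpen_setOf_agree n x.1).preimage continuous_subtype_val).mem_nhds (Agree.refl n x.1)
  refine (continuousAt_const (y := f x)).congr ?_
  exact Filter.mem_of_superset hnx fun y hy => hn y hy

theorem not_isEndpoint_isPlain (hd : IsOdometerSeq d) {w : InfWord} (hw : w ∈ odoSpace d)
    (h : ¬ IsEndpoint d w) (n : ℕ) : (w n).IsPlain := by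
  rcases mem_odoSpace_cases hd hw with h' | rfl | h'
  · exact absurd h' h
  · exact isPlain_cInf n
  · exact h'.isPlain n

theorem not_isPlain_marker {l e : ℕ} {x : InfWord}
    (hx : x = arcSource d l e ∨ x = arcTarget d l e) : ¬ (x (l + 1)).IsPlain := by
  rcases hx with rfl | rfl
  · exact not_isPlain_arcSource e
  · exact not_isPlain_arcTarget e

/-- The arc number `e` of the level `l` is the image of an edge. -/
def IsArcImage (Y : TopGraph.{u}) (φ : Y.carrier → odoSpace d) (l e : ℕ) : Prop :=
  ∃ y z, Y.graph.Adj y z ∧ (φ y).1 = arcSource d l e ∧ (φ z).1 = arcTarget d l e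

/-- A coloring that depends on a prefix has a monochromatic edge of large level in any subgraph
without continuous two-coloring. -/
theorem exists_monochromatic_arc (hd : IsOdometerSeq d) {Y : TopGraph.{u}} (hY : 3 ≤ Y.ccn)
    {φ : Y.carrier → odoSpace d} (hφ : Continuous φ)
    (hadj : ∀ y z, Y.graph.Adj y z → OdoEdge d (φ y).1 (φ z).1) (N n : ℕ) {h : InfWord → Bool}
    (hh : ∀ x y, Agree n x y → h x = h y) :
    ∃ l e, N ≤ l ∧ IsArcIndex d l e ∧ IsArcImage Y φ l e ∧
      h (arcSource d l e) = h (arcTarget d l e) := by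
  classical
  by_contra! hc
  let A : Set InfWord := {w | ∃ l e, l < N ∧ IsArcIndex d l e ∧ w = arcSource d l e}
  let B : Set InfWord := {w | ∃ l e, l < N ∧ IsArcIndex d l e ∧ w = arcTarget d l e}
  -- Levels below N are colored by orientation, whatever h is. The N + 1 first letters of a point
  -- that is not an endpoint rule out these levels nearby, so continuity is preserved.
  let c : odoSpace d → Bool := fun w =>
    if w.1 ∈ A then true else if w.1 ∈ B then false else h w.1
  have hcont : Continuous c := by
    refine continuous_of_forall_agree fun x => ?_
    by_cases hx : IsEndpoint d x.1
    · obtain ⟨n, hn⟩ := hx.exists_isolated hd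
      exact ⟨n, fun y hy => by rw [Subtype.ext (hn y.1 y.2 hy)]⟩
    · have hA : ∀ y : odoSpace d, Agree (N + 1) x.1 y.1 → y.1 ∉ A ∧ y.1 ∉ B := by
        intro y hxy
        constructor
        · rintro ⟨l, e, hl, he, hy⟩
          have := hxy (l + 1) (by omega)
          exact not_isPlain_marker (Or.inl hy)
            (this ▸ not_isEndpoint_isPlain hd x.2 hx (l + 1))
        · rintro ⟨l, e, hl, he, hy⟩
          have := hxy (l + 1) (by omega)
          exact not_isPlain_marker (Or.inr hy)
            (this ▸ not_isEndpoint_isPlain hd x.2 hx (l + 1))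
      refine ⟨max (N + 1) n, fun y hy => ?_⟩
      obtain ⟨h1, h2⟩ := hA x (Agree.refl _ _)
      obtain ⟨h3, h4⟩ := hA y (hy.mono (le_max_left _ _))
      simp only [c, h1, h2, h3, h4, if_false]
      exact hh _ _ (hy.mono (le_max_right _ _))
  have main : ∀ y z, Y.graph.Adj y z → OdoArc d (φ y).1 (φ z).1 → c (φ y) ≠ c (φ z) := by
    intro y z hyz harc
    obtain ⟨l, e, he, h1, h2⟩ := odoArc_iff.1 harc
    by_cases hl : l < N
    · have hA : (φ y).1 ∈ A := ⟨l, e, hl, he, h1⟩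
      have hA' : (φ z).1 ∉ A := by
        rintro ⟨l', e', -, -, h'⟩
        exact arcSource_ne_arcTarget _ _ _ _ _ (h'.symm.trans h2)
      have hB : (φ z).1 ∈ B := ⟨l, e, hl, he, h2⟩
      simp [c, hA, hA', hB]
    · have hA : (φ y).1 ∉ A := by
        rintro ⟨l', e', hl', he', h'⟩
        obtain ⟨rfl, -⟩ := arcSource_inj hd he he' (h1.symm.trans h')
        exact hl hl'
      have hA' : (φ z).1 ∉ A := by
        rintro ⟨l', e', -, -, h'⟩
        exact arcSource_ne_arcTarget _ _ _ _ _ (h'.symm.trans h2)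
      have hB' : (φ y).1 ∉ B := by
        rintro ⟨l', e', -, -, h'⟩
        exact arcSource_ne_arcTarget _ _ _ _ _ (h1.symm.trans h')
      have hB : (φ z).1 ∉ B := by
        rintro ⟨l', e', hl', he', h'⟩
        obtain ⟨rfl, -⟩ := arcTarget_inj hd he he' (h2.symm.trans h')
        exact hl hl'
      simp only [c, hA, hA', hB, hB', if_false]
      rw [h1, h2]
      exact hc l e (not_lt.1 hl) he ⟨y, z, hyz, h1, h2⟩
  refine (TopGraph.three_le_ccn_iff Y).1 hY ⟨c ∘ φ, hcont.comp hφ, fun y z hyz => ?_⟩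
  rcases hadj y z hyz with h | h
  · exact main y z hyz h
  · exact (main z y hyz.symm h).symm

/-- The coloring by the parity of the prefix of length `n`, except that the points with first letter
`c` get the color `b` and that the colors are exchanged between `r` and `R`. -/
noncomputable def parityColor (d : ℕ → ℕ) (n : ℕ) (b : Bool) (r R : ℕ) (w : InfWord) : Bool :=
  open Classical in
  if w 0 = Letter.c then b else
    (decide (prefixVal d n w % 2 = 0) ^^ decide (r < prefixVal d n w ∧ prefixVal d n w ≤ R))

theorem parityColor_congr (d : ℕ → ℕ) {n : ℕ} (hn : 0 < n) (b : Bool) (r R : ℕ) {w w' : InfWord}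
    (h : Agree n w w') : parityColor d n b r R w = parityColor d n b r R w' := by
  rw [parityColor, parityColor, prefixVal_congr d h, h 0 hn]

theorem parityColor_cInf (d : ℕ → ℕ) (n : ℕ) (b : Bool) (r R : ℕ) :
    parityColor d n b r R cInf = b := by simp [parityColor, cInf]

theorem parityColor_odoPoint (hd : IsOdometerSeq d) (n : ℕ) (b : Bool) (r R i : ℕ) :
    parityColor d n b r R (odoPoint d i) =
      (decide (i % radixProd d n % 2 = 0) ^^
        decide (r < i % radixProd d n ∧ i % radixProd d n ≤ R)) := by
  rw [parityColor, if_neg (by simp [odoPoint]), hd.prefixVal_odoPoint]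

theorem agree_arc_of_agree_cycleVertex {l l' e e' : ℕ} (hl : l ≤ l')
    (h : Agree (l + 1) (cycleVertex d l' e') (cycleVertex d l e))
    (h' : Agree (l + 1) (cycleVertex d l' (e' + 1)) (cycleVertex d l (e + 1))) :
    Agree (l + 1) (arcSource d l' e') (arcSource d l e) ∧
      Agree (l + 1) (arcTarget d l' e') (arcTarget d l e) :=
  ⟨(((agree_arcSource e').mono (by omega)).trans h).trans (agree_arcSource e).symm,
    (((agree_arcTarget e').mono (by omega)).trans h').trans (agree_arcTarget e).symm⟩

/-- A subgraph without continuous two-coloring contains arcs of arbitrarily large level that are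
close to any given arc. -/
theorem exists_close_arc (hd : IsOdometerSeq d) {Y : TopGraph.{u}} (hY : 3 ≤ Y.ccn)
    {φ : Y.carrier → odoSpace d} (hφ : Continuous φ)
    (hadj : ∀ y z, Y.graph.Adj y z → OdoEdge d (φ y).1 (φ z).1) (N : ℕ) {l e : ℕ}
    (he : IsArcIndex d l e) :
    ∃ l' e', N ≤ l' ∧ IsArcIndex d l' e' ∧ IsArcImage Y φ l' e' ∧
      Agree (l + 1) (arcSource d l' e') (arcSource d l e) ∧
      Agree (l + 1) (arcTarget d l' e') (arcTarget d l e) := by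
  have key : ∀ (b : Bool) (r R : ℕ), ∃ l' e', N ≤ l' ∧ l + 1 ≤ l' ∧ IsArcIndex d l' e' ∧
      IsArcImage Y φ l' e' ∧ parityColor d (l + 2) b r R (cycleVertex d l' e') =
        parityColor d (l + 2) b r R (cycleVertex d l' (e' + 1)) := by
    intro b r R
    obtain ⟨l', e', hl', he', hi, hc⟩ := exists_monochromatic_arc hd hY hφ hadj (max N (l + 1))
      (l + 2) fun x y => parityColor_congr d (by omega) b r R
    have h1 := (le_max_left _ _).trans hl'
    have h2 := (le_max_right _ _).trans hl'
    refine ⟨l', e', h1, h2, he', hi, ?_⟩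
    rwa [parityColor_congr d (by omega) b r R ((agree_arcSource e').mono (by omega)),
      parityColor_congr d (by omega) b r R ((agree_arcTarget e').mono (by omega))] at hc
  have hM : radixProd d (l + 2) = 2 * (oddPart d l * d (l + 1)) := by
    rw [hd.radixProd_succ_eq, hd.oddPart_succ]
  have hMpos := hd.radixProd_pos (l + 2)
  have hstep : ∀ i, ((i % radixProd d (l + 2) + 1 < radixProd d (l + 2) ∧
      (i + 1) % radixProd d (l + 2) = i % radixProd d (l + 2) + 1) ∨
      (i % radixProd d (l + 2) + 1 = radixProd d (l + 2) ∧ (i + 1) % radixProd d (l + 2) = 0)) := by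
    intro i
    have := Nat.mod_lt i hMpos
    rcases (Nat.succ_le_of_lt this).lt_or_eq with h | h
    · left
      refine ⟨h, ?_⟩
      rw [← Nat.mod_add_mod, Nat.mod_eq_of_lt h]
    · right
      refine ⟨h, ?_⟩
      rw [← Nat.mod_add_mod]
      rw [Nat.succ_eq_add_one] at h
      rw [h, Nat.mod_self]
  -- Modulo M_{l+2} = 2 P_{l+1}, the last orbit point of every cycle of large level has the same
  -- residue P_{l+1}, which is odd.
  have hlast : ∀ l', l + 1 ≤ l' → oddPart d l' % radixProd d (l + 2) = oddPart d l * d (l + 1) := by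
    intro l' h
    have h1 : oddPart d l' % radixProd d (l + 2) = oddPart d (l + 1) % radixProd d (l + 2) :=
      hd.oddPart_modEq h
    rw [h1, hd.oddPart_succ, Nat.mod_eq_of_lt]
    rw [hM] at hMpos ⊢
    omega
  have hodd : oddPart d l * d (l + 1) % 2 = 1 := by
    rw [← hd.oddPart_succ]
    exact Nat.odd_iff.1 (oddPart_odd d _)
  have hD := hd.two_le (l + 1)
  rcases he.cases with rfl | ⟨r, hr, rfl⟩ | rfl
  -- With r = R = 0 no color is exchanged. Parity alternates along the orbit, even at the wraparound
  -- as M_{l+2} is even, and P_{l+1} is odd; giving c the color of 0 leaves only the first arc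
  -- monochromatic.
  · obtain ⟨l', e', hN, hl, he', him, hc⟩ := key true 0 0
    refine ⟨l', e', hN, he', him, ?_⟩
    rcases he'.cases with rfl | ⟨i, hi, rfl⟩ | rfl
    · refine agree_arc_of_agree_cycleVertex (by omega) ?_ ?_
      · simpa using Agree.refl _ _
      · rw [cycleVertex_succ (Nat.zero_le _), cycleVertex_succ (Nat.zero_le _)]
        exact Agree.refl _ _
    · exfalso
      rw [cycleVertex_succ hi.le, cycleVertex_succ hi, parityColor_odoPoint hd,
        parityColor_odoPoint hd] at hc
      rcases hstep i with ⟨h1, h2⟩ | ⟨h1, h2⟩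
      · rw [h2] at hc
        generalize i % radixProd d (l + 2) = j at *
        simp at hc
        grind
      · rw [h2] at hc
        generalize i % radixProd d (l + 2) = j at *
        simp at hc
        grind
    · exfalso
      rw [cycleVertex_last, cycleVertex_succ le_rfl, parityColor_cInf, parityColor_odoPoint hd,
        hlast l' hl, hodd] at hc
      simp at hc
      grind
  -- Exchanging the colors on (r, R] breaks the alternation only after the residues r and R. The
  -- difference R - r = M_{l+2} - 2 P_l is a multiple of 2 P_l = M_{l+1}, so both breaks look like
  -- the given arc on l + 1 letters. As r < P_{l+1} ≤ R, the residue P_{l+1} is exchanged and gets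
  -- the color of 0, so c can take the other color.
  · obtain ⟨l', e', hN, hl, he', him, hc⟩ := key false r (r + 2 * oddPart d l * (d (l + 1) - 1))
    refine ⟨l', e', hN, he', him, ?_⟩
    have hR : r + 2 * oddPart d l * (d (l + 1) - 1) + 2 * oddPart d l =
        r + radixProd d (l + 2) := by
      obtain ⟨t, ht⟩ := Nat.exists_eq_add_of_le hD
      rw [hM, ht, show 2 + t - 1 = t + 1 by omega]
      ring
    have hP : 2 * oddPart d l ≤ oddPart d l * d (l + 1) := by
      rw [mul_comm]
      exact Nat.mul_le_mul_left _ hD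
    set R := r + 2 * oddPart d l * (d (l + 1) - 1) with hRdef
    rcases he'.cases with rfl | ⟨i, hi, rfl⟩ | rfl
    · exfalso
      rw [cycleVertex_zero, cycleVertex_succ (Nat.zero_le _), parityColor_cInf,
        parityColor_odoPoint hd] at hc
      simp at hc
    · have hir : i ≡ r [MOD radixProd d (l + 1)] := by
        have hj : i % radixProd d (l + 2) = r ∨ i % radixProd d (l + 2) = R := by
          rw [cycleVertex_succ hi.le, cycleVertex_succ hi, parityColor_odoPoint hd,
            parityColor_odoPoint hd] at hc
          rcases hstep i with ⟨h1, h2⟩ | ⟨h1, h2⟩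
          · rw [h2] at hc
            generalize i % radixProd d (l + 2) = j at *
            by_contra! hne
            have e1 : (r < j ∧ j ≤ R) ↔ (r < j + 1 ∧ j + 1 ≤ R) := by omega
            have e2 : decide ((j + 1) % 2 = 0) = !decide (j % 2 = 0) := by
              rcases Nat.mod_two_eq_zero_or_one j with h | h
              · have : (j + 1) % 2 = 1 := by omega
                simp [h, this]
              · have : (j + 1) % 2 = 0 := by omega
                simp [h, this]
            rw [e2, decide_eq_decide.2 e1] at hc
            revert hc
            cases decide (j % 2 = 0) <;> cases decide (r < j + 1 ∧ j + 1 ≤ R) <;> simp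
          · rw [h2] at hc
            exfalso
            generalize i % radixProd d (l + 2) = j at *
            have e1 : ¬ (r < j ∧ j ≤ R) := by omega
            have e2 : ¬ (j % 2 = 0) := by omega
            simp [e1, e2] at hc
        have hdvd : radixProd d (l + 1) ∣ radixProd d (l + 2) := radixProd_dvd d (by omega)
        have h1 : i ≡ i % radixProd d (l + 2) [MOD radixProd d (l + 1)] :=
          (Nat.ModEq.of_dvd hdvd (Nat.mod_modEq _ _)).symm
        refine h1.trans ?_
        rcases hj with h | h <;> rw [h]
        rw [hRdef, hd.radixProd_succ_eq]
        exact Nat.add_mul_mod_self_left _ _ _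
      refine agree_arc_of_agree_cycleVertex (by omega) ?_ ?_
      · rw [cycleVertex_succ hi.le, cycleVertex_succ hr.le, hd.agree_odoPoint_iff]
        exact hir
      · rw [cycleVertex_succ hi, cycleVertex_succ hr, hd.agree_odoPoint_iff]
        exact hir.add_right 1
    · exfalso
      rw [cycleVertex_last, cycleVertex_succ le_rfl, parityColor_cInf, parityColor_odoPoint hd,
        hlast l' hl, hodd] at hc
      have : r < oddPart d l * d (l + 1) ∧ oddPart d l * d (l + 1) ≤ R := by omega
      simp [this] at hc
  -- Here c has the color of the odd residue P_{l+1}, so only the last arc is monochromatic.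
  · obtain ⟨l', e', hN, hl, he', him, hc⟩ := key false 0 0
    refine ⟨l', e', hN, he', him, ?_⟩
    rcases he'.cases with rfl | ⟨i, hi, rfl⟩ | rfl
    · exfalso
      rw [cycleVertex_zero, cycleVertex_succ (Nat.zero_le _), parityColor_cInf,
        parityColor_odoPoint hd] at hc
      simp at hc
    · exfalso
      rw [cycleVertex_succ hi.le, cycleVertex_succ hi, parityColor_odoPoint hd,
        parityColor_odoPoint hd] at hc
      rcases hstep i with ⟨h1, h2⟩ | ⟨h1, h2⟩
      · rw [h2] at hc
        generalize i % radixProd d (l + 2) = j at *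
        simp at hc
        grind
      · rw [h2] at hc
        generalize i % radixProd d (l + 2) = j at *
        simp at hc
        grind
    · refine agree_arc_of_agree_cycleVertex (by omega) ?_ ?_
      · rw [cycleVertex_succ le_rfl, cycleVertex_succ le_rfl, hd.agree_odoPoint_iff]
        exact hd.oddPart_modEq (by omega)
      · rw [cycleVertex_last, cycleVertex_last]
        exact Agree.refl _ _

/-- The arcs can be sent to arcs of pairwise distinct levels in a subgraph without continuous
two-coloring. -/
theorem exists_arc_embedding (hd : IsOdometerSeq d) {Y : TopGraph.{u}} (hY : 3 ≤ Y.ccn)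
    {φ : Y.carrier → odoSpace d} (hφ : Continuous φ)
    (hadj : ∀ y z, Y.graph.Adj y z → OdoEdge d (φ y).1 (φ z).1) :
    ∃ g h : ℕ → ℕ → ℕ, (∀ l e l' e', g l e = g l' e' → l = l' ∧ e = e') ∧
      ∀ l e, IsArcIndex d l e → IsArcIndex d (g l e) (h l e) ∧ IsArcImage Y φ (g l e) (h l e) ∧
        Agree (l + 1) (arcSource d (g l e) (h l e)) (arcSource d l e) ∧
        Agree (l + 1) (arcTarget d (g l e) (h l e)) (arcTarget d l e) := by
  have key : ∀ k N : ℕ, ∃ q : ℕ × ℕ, N ≤ q.1 ∧ (IsArcIndex d k.unpair.1 k.unpair.2 →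
      IsArcIndex d q.1 q.2 ∧ IsArcImage Y φ q.1 q.2 ∧
      Agree (k.unpair.1 + 1) (arcSource d q.1 q.2) (arcSource d k.unpair.1 k.unpair.2) ∧
      Agree (k.unpair.1 + 1) (arcTarget d q.1 q.2) (arcTarget d k.unpair.1 k.unpair.2)) := by
    intro k N
    by_cases he : IsArcIndex d k.unpair.1 k.unpair.2
    · obtain ⟨l', e', hN, h⟩ := exists_close_arc hd hY hφ hadj N he
      exact ⟨(l', e'), hN, fun _ => h⟩
    · exact ⟨(N, 0), le_rfl, fun h => absurd h he⟩
  choose q hq hq' using key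
  -- Arcs are enumerated through the pairing function, and each one is sent to a level above the
  -- preceding choice, which makes the levels distinct.
  let s : ℕ → ℕ × ℕ := fun k => Nat.rec (q 0 0) (fun k p => q (k + 1) (p.1 + 1)) k
  have hs : StrictMono fun k => (s k).1 := strictMono_nat_of_lt_succ fun k => hq (k + 1) _
  have hs' : ∀ k, ∃ N, s k = q k N := by
    rintro (_ | k)
    · exact ⟨0, rfl⟩
    · exact ⟨_, rfl⟩
  refine ⟨fun l e => (s (Nat.pair l e)).1, fun l e => (s (Nat.pair l e)).2, ?_, ?_⟩
  · intro l e l' e' h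
    exact Nat.pair_eq_pair.1 (hs.injective h)
  · intro l e he
    obtain ⟨N, hN⟩ := hs' (Nat.pair l e)
    have := hq' (Nat.pair l e) N
    rw [Nat.unpair_pair] at this
    simpa only [hN] using this he

theorem injContLE_of_injContLE (hd : IsOdometerSeq d) {Y : TopGraph.{u}} (hY : Y ∈ classK.{u})
    (h : Y.InjContLE (odoTopGraph d)) : (odoTopGraph d).InjContLE Y := by
  obtain ⟨φ, hinj, hφ, hadj⟩ : ∃ φ : Y.carrier → odoSpace d, Function.Injective φ ∧
    Continuous φ ∧ ∀ y z, Y.graph.Adj y z → OdoEdge d (φ y).1 (φ z).1 := h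
  have : CompactSpace Y.carrier := hY.1.2.2
  obtain ⟨g, h, hgh, harc⟩ := exists_arc_embedding hd hY.2 hφ hadj
  have hclosed : IsClosed (Set.range fun y => (φ y).1) :=
    (isCompact_range (continuous_subtype_val.comp hφ)).isClosed
  have hend : ∀ l e, IsArcIndex d l e → (∃ y, (φ y).1 = arcSource d (g l e) (h l e)) ∧
      ∃ y, (φ y).1 = arcTarget d (g l e) (h l e) := by
    intro l e he
    obtain ⟨y, z, -, hy, hz⟩ := (harc l e he).2.1
    exact ⟨⟨y, hy⟩, ⟨z, hz⟩⟩
  have key : ∀ w : odoSpace d, ∃ y, (∀ l e, IsArcIndex d l e →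
      (w.1 = arcSource d l e → (φ y).1 = arcSource d (g l e) (h l e)) ∧
      (w.1 = arcTarget d l e → (φ y).1 = arcTarget d (g l e) (h l e))) ∧
      (¬ IsEndpoint d w.1 → (φ y).1 = w.1) := by
    intro w
    by_cases hw : IsEndpoint d w.1
    · have hw' := hw
      obtain ⟨l, e, he, hle | hle⟩ := hw'
      · obtain ⟨y, hy⟩ := (hend l e he).1
        refine ⟨y, fun l' e' he' => ⟨fun h' => ?_, fun h' => ?_⟩, fun h' => absurd hw h'⟩
        · obtain ⟨rfl, rfl⟩ := arcSource_inj hd he he' (hle.symm.trans h')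
          exact hy
        · exact absurd (hle.symm.trans h') (arcSource_ne_arcTarget _ _ _ _ _)
      · obtain ⟨y, hy⟩ := (hend l e he).2
        refine ⟨y, fun l' e' he' => ⟨fun h' => ?_, fun h' => ?_⟩, fun h' => absurd hw h'⟩
        · exact absurd (h'.symm.trans hle) (arcSource_ne_arcTarget _ _ _ _ _)
        · obtain ⟨rfl, rfl⟩ := arcTarget_inj hd he he' (hle.symm.trans h')
          exact hy
    -- A point that is not an endpoint is a limit of endpoints of levels tending to infinity, hence
    -- of the chosen ones, which lie in the closed image of Y.
    · have hmem : w.1 ∈ Set.range fun y => (φ y).1 := by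
        rw [← hclosed.closure_eq, mem_closure_iff_agree]
        intro n
        obtain ⟨x, ⟨l, e, he, hx⟩, hwx⟩ := mem_odoSpace_iff.1 w.2 (n + 1)
        have hl := le_level_of_isPlain hx hwx fun j _ => not_isEndpoint_isPlain hd w.2 hw j
        have ha := (harc l e he).2.2
        rcases hx with rfl | rfl
        · exact ⟨_, (hend l e he).1, (hwx.mono (by omega)).trans (ha.1.symm.mono (by omega))⟩
        · exact ⟨_, (hend l e he).2, (hwx.mono (by omega)).trans (ha.2.symm.mono (by omega))⟩
      obtain ⟨y, hy⟩ := hmem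
      exact ⟨y, fun l e he => ⟨fun h' => absurd ⟨l, e, he, Or.inl h'⟩ hw,
        fun h' => absurd ⟨l, e, he, Or.inr h'⟩ hw⟩, fun _ => hy⟩
  choose ψ hψ hψ' using key
  have hψend : ∀ w : odoSpace d, IsEndpoint d w.1 → IsEndpoint d (φ (ψ w)).1 := by
    rintro w ⟨l, e, he, hle | hle⟩
    · exact ⟨_, _, (harc l e he).1, Or.inl ((hψ w l e he).1 hle)⟩
    · exact ⟨_, _, (harc l e he).1, Or.inr ((hψ w l e he).2 hle)⟩
  have hψcont : Continuous ψ := by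
    -- As Y is compact, φ is an embedding, and continuity can be tested after composing with it.
    rw [(hφ.isClosedEmbedding hinj).isInducing.continuous_iff,
      Topology.IsInducing.subtypeVal.continuous_iff,
      continuous_subtype_iff_agree]
    intro x m
    by_cases hx : IsEndpoint d x.1
    · obtain ⟨n, hn⟩ := hx.exists_isolated hd
      refine ⟨n, fun y hy => ?_⟩
      rw [Subtype.ext (hn y.1 y.2 hy)]
      exact Agree.refl _ _
    -- An endpoint that shares m + 1 letters with x has level at least m, so it is moved without
    -- changing these letters.
    · refine ⟨m + 1, fun y hy => ?_⟩
      simp only [Function.comp_apply]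
      rw [hψ' x hx]
      by_cases hy' : IsEndpoint d y.1
      · obtain ⟨l, e, he, hle⟩ := hy'
        have hl := le_level_of_isPlain hle hy fun j _ => not_isEndpoint_isPlain hd x.2 hx j
        have ha := (harc l e he).2.2
        refine (hy.mono (by omega)).trans ?_
        rcases hle with hle | hle
        · rw [(hψ y l e he).1 hle, hle]
          exact ha.1.symm.mono (by omega)
        · rw [(hψ y l e he).2 hle, hle]
          exact ha.2.symm.mono (by omega)
      · rw [hψ' y hy']
        exact hy.mono (by omega)
  have hψinj : Function.Injective ψ := by
    intro w w' hww
    have hww' : (φ (ψ w)).1 = (φ (ψ w')).1 := by rw [hww]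
    by_cases hw : IsEndpoint d w.1 <;> by_cases hw' : IsEndpoint d w'.1
    · obtain ⟨l, e, he, hle⟩ := hw
      obtain ⟨l', e', he', hle'⟩ := hw'
      rcases hle with hle | hle <;> rcases hle' with hle' | hle'
      · rw [(hψ w l e he).1 hle, (hψ w' l' e' he').1 hle'] at hww'
        obtain ⟨rfl, rfl⟩ := hgh _ _ _ _ (arcSource_inj hd (harc _ _ he).1 (harc _ _ he').1 hww').1
        exact Subtype.ext (hle.trans hle'.symm)
      · rw [(hψ w l e he).1 hle, (hψ w' l' e' he').2 hle'] at hww'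
        exact absurd hww' (arcSource_ne_arcTarget _ _ _ _ _)
      · rw [(hψ w l e he).2 hle, (hψ w' l' e' he').1 hle'] at hww'
        exact absurd hww'.symm (arcSource_ne_arcTarget _ _ _ _ _)
      · rw [(hψ w l e he).2 hle, (hψ w' l' e' he').2 hle'] at hww'
        obtain ⟨rfl, rfl⟩ := hgh _ _ _ _ (arcTarget_inj hd (harc _ _ he).1 (harc _ _ he').1 hww').1
        exact Subtype.ext (hle.trans hle'.symm)
    · have := hψend w hw
      rw [hww', hψ' w' hw'] at this
      exact absurd this hw'
    · have := hψend w' hw'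
      rw [← hww', hψ' w hw] at this
      exact absurd this hw
    · rw [hψ' w hw, hψ' w' hw'] at hww'
      exact Subtype.ext hww'
  have main : ∀ w w' : odoSpace d, OdoArc d w.1 w'.1 → Y.graph.Adj (ψ w) (ψ w') := by
    intro w w' hww
    obtain ⟨l, e, he, h1, h2⟩ := odoArc_iff.1 hww
    obtain ⟨y, z, hyz, hy, hz⟩ := (harc l e he).2.1
    have e1 : ψ w = y := hinj (Subtype.ext (((hψ w l e he).1 h1).trans hy.symm))
    have e2 : ψ w' = z := hinj (Subtype.ext (((hψ w' l e he).2 h2).trans hz.symm))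
    rwa [e1, e2]
  refine ⟨ψ, hψinj, hψcont, ?_⟩
  rintro w w' (hww | hww)
  · exact main _ _ hww
  · exact (main _ _ hww).symm

theorem odoTopGraph_mem_classK (hd : IsOdometerSeq d) : odoTopGraph d ∈ classK.{0} :=
  ⟨isZeroDimMetrizableCompact_odoTopGraph hd, three_le_ccn_odoTopGraph hd⟩

theorem isInjMinimalInK_odoTopGraph (hd : IsOdometerSeq d) :
    IsInjMinimalInK.{u, 0} (odoTopGraph d) :=
  ⟨odoTopGraph_mem_classK hd, fun _ hY h => injContLE_of_injContLE hd hY h⟩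

end

/-! ### Limits of edges -/

section

variable {d : ℕ → ℕ}

/-- The pair `(u, v)` is in the closure of the graph. -/
def LimEdge (d : ℕ → ℕ) (u v : InfWord) : Prop :=
  ∀ m, ∃ x y, OdoEdge d x y ∧ Agree m u x ∧ Agree m v y

theorem LimEdge.symm {u v : InfWord} (h : LimEdge d u v) : LimEdge d v u := fun m =>
  let ⟨x, y, hxy, hx, hy⟩ := h m
  ⟨y, x, hxy.symm, hy, hx⟩

/-- An endpoint is isolated and has a single neighbor, so taking the closure adds nothing at it. -/
theorem LimEdge.odoEdge (hd : IsOdometerSeq d) {u v : InfWord} (hu : IsEndpoint d u)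
    (h : LimEdge d u v) : OdoEdge d u v := by
  obtain ⟨n, hn⟩ := hu.exists_isolated hd
  have key : ∀ m, ∃ y, OdoEdge d u y ∧ Agree m v y := by
    intro m
    obtain ⟨x, y, hxy, hx, hy⟩ := h (max m n)
    obtain rfl : x = u := hn x hxy.isEndpoint.mem (hx.mono (le_max_right _ _))
    exact ⟨y, hxy, hy.mono (le_max_left _ _)⟩
  obtain ⟨y, hy, -⟩ := key 0
  have : v = y := eq_of_forall_agree fun m => by
    obtain ⟨z, hz, hvz⟩ := key m
    rwa [hy.unique hd hz]
  rwa [this]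

theorem LimEdge.not_isEndpoint (hd : IsOdometerSeq d) {u v : InfWord} (hu : ¬ IsEndpoint d u)
    (h : LimEdge d u v) : ¬ IsEndpoint d v := fun hv => hu (h.symm.odoEdge hd hv).symm.isEndpoint

theorem LimEdge.exists_cycleVertex (hd : IsOdometerSeq d) {u v : InfWord} (hu : u ∈ odoSpace d)
    (hu' : ¬ IsEndpoint d u) (h : LimEdge d u v) (m : ℕ) :
    ∃ l e, m ≤ l ∧ IsArcIndex d l e ∧
      ((Agree (m + 1) u (cycleVertex d l e) ∧ Agree (m + 1) v (cycleVertex d l (e + 1))) ∨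
        (Agree (m + 1) v (cycleVertex d l e) ∧ Agree (m + 1) u (cycleVertex d l (e + 1)))) := by
  obtain ⟨x, y, hxy, hx, hy⟩ := h (m + 1)
  rcases hxy with hxy | hxy <;> obtain ⟨l, e, he, rfl, rfl⟩ := odoArc_iff.1 hxy
  · have hl := le_level_of_isPlain (Or.inl rfl) hx fun j _ => not_isEndpoint_isPlain hd hu hu' j
    exact ⟨l, e, hl, he, Or.inl ⟨hx.trans ((agree_arcSource e).mono (by omega)),
      hy.trans ((agree_arcTarget e).mono (by omega))⟩⟩
  · have hl := le_level_of_isPlain (Or.inr rfl) hx fun j _ => not_isEndpoint_isPlain hd hu hu' j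
    exact ⟨l, e, hl, he, Or.inr ⟨hy.trans ((agree_arcSource e).mono (by omega)),
      hx.trans ((agree_arcTarget e).mono (by omega))⟩⟩

/-- The limit of the points `o^i(0^∞)`, where `i` is the half of the period at the level `l`. -/
def IsHalf (d : ℕ → ℕ) (w : InfWord) : Prop := ∀ n, Agree (n + 1) w (odoPoint d (oddPart d n))

theorem IsHalf.unique {w w' : InfWord} (h : IsHalf d w) (h' : IsHalf d w') : w = w' :=
  eq_of_forall_agree fun n => ((h n).trans (h' n).symm).mono (by omega)

theorem not_agree_cInf_odoPoint {n i : ℕ} : ¬ Agree (n + 1) cInf (odoPoint d i) :=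
  fun h => cInf_ne_odoPoint _ _ (h 0 (by omega))

/-- Only the first and the last arcs of a level come near c^∞; their other ends tend to 0^∞ and to
the limit of o^{P_l}(0^∞). The first letters 0 and 1 prevent mixing the two cases along the
prefixes. -/
theorem LimEdge.of_cInf (hd : IsOdometerSeq d) {v : InfWord} (h : LimEdge d cInf v) :
    (v 0 = Letter.num 0 ∧ v = odoPoint d 0) ∨ (v 0 = Letter.num 1 ∧ IsHalf d v) := by
  have key : ∀ m, Agree (m + 1) v (odoPoint d 0) ∨ Agree (m + 1) v (odoPoint d (oddPart d m)) := by
    intro m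
    obtain ⟨l, e, hl, he, ⟨h1, h2⟩ | ⟨h1, h2⟩⟩ :=
      h.exists_cycleVertex hd (cInf_mem d) not_isEndpoint_cInf m
    · rcases he.cases with rfl | ⟨i, hi, rfl⟩ | rfl
      · rw [cycleVertex_succ (Nat.zero_le _)] at h2
        exact Or.inl h2
      · rw [cycleVertex_succ hi.le] at h1
        exact absurd h1 not_agree_cInf_odoPoint
      · rw [cycleVertex_succ le_rfl] at h1
        exact absurd h1 not_agree_cInf_odoPoint
    · rcases he.cases with rfl | ⟨i, hi, rfl⟩ | rfl
      · rw [cycleVertex_succ (Nat.zero_le _)] at h2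
        exact absurd h2 not_agree_cInf_odoPoint
      · rw [cycleVertex_succ hi] at h2
        exact absurd h2 not_agree_cInf_odoPoint
      · rw [cycleVertex_succ le_rfl] at h1
        exact Or.inr (h1.trans ((hd.agree_odoPoint_iff _ _ _).2 (hd.oddPart_modEq hl)))
  have h0 : odoPoint d 0 0 = Letter.num 0 := by rw [hd.odoPoint_zero_eq]
  have h1 : ∀ m, odoPoint d (oddPart d m) 0 = Letter.num 1 := fun m => by
    rw [hd.odoPoint_zero_eq, Nat.odd_iff.1 (oddPart_odd d m)]
  rcases key 0 with h | h
  · have hv : v 0 = Letter.num 0 := (h 0 (by omega)).trans h0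
    refine Or.inl ⟨hv, eq_of_forall_agree fun n => ?_⟩
    rcases key n with h' | h'
    · exact h'.mono (by omega)
    · have := (h' 0 (by omega)).trans (h1 n)
      rw [hv] at this
      simp at this
  · have hv : v 0 = Letter.num 1 := (h 0 (by omega)).trans (h1 0)
    refine Or.inr ⟨hv, fun n => ?_⟩
    rcases key n with h' | h'
    · have := (h' 0 (by omega)).trans h0
      rw [hv] at this
      simp at this
    · exact h'

/-! ### Shifts in the odometer -/

/-- The second word is obtained from the first one by adding the integer `e`. -/
def IsShift (d : ℕ → ℕ) (u v : InfWord) (e : ℤ) : Prop :=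
  ∀ n, (radixProd d n : ℤ) ∣ (prefixVal d n v : ℤ) - prefixVal d n u - e

theorem IsShift.trans {u v w : InfWord} {e f : ℤ} (h : IsShift d u v e) (h' : IsShift d v w f) :
    IsShift d u w (e + f) := fun n => by
  refine (dvd_add (h n) (h' n)).trans (dvd_of_eq ?_)
  ring

theorem IsShift.refl (u : InfWord) : IsShift d u u 0 := fun n => by simp

theorem IsShift.symm {u v : InfWord} {e : ℤ} (h : IsShift d u v e) : IsShift d v u (-e) :=
  fun n => by
    refine ((h n).neg_right).trans (dvd_of_eq ?_)
    ring

theorem radixProd_dvd_prefixVal_sub (d : ℕ → ℕ) {m n : ℕ} (h : m ≤ n) (w : InfWord) :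
    (radixProd d m : ℤ) ∣ (prefixVal d n w : ℤ) - prefixVal d m w := by
  induction n, h using Nat.le_induction with
  | base => simp
  | succ n h ih =>
    have h1 : prefixVal d (n + 1) w = prefixVal d n w + radixProd d n * (w n).digit :=
      Finset.sum_range_succ _ _
    have h2 : (radixProd d m : ℤ) ∣ radixProd d n := Int.natCast_dvd_natCast.2 (radixProd_dvd d h)
    rw [h1]
    refine (dvd_add ih (h2.mul_right ((w n).digit : ℤ))).trans (dvd_of_eq ?_)
    push_cast
    ring

theorem dvd_prefixVal_sub_mono {u v : InfWord} {e : ℤ} {m n : ℕ} (hmn : m ≤ n)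
    (h : (radixProd d n : ℤ) ∣ (prefixVal d n v : ℤ) - prefixVal d n u - e) :
    (radixProd d m : ℤ) ∣ (prefixVal d m v : ℤ) - prefixVal d m u - e := by
  have h2 : (radixProd d m : ℤ) ∣ radixProd d n := Int.natCast_dvd_natCast.2 (radixProd_dvd d hmn)
  refine (((h2.trans h).add (radixProd_dvd_prefixVal_sub d hmn u)).sub
    (radixProd_dvd_prefixVal_sub d hmn v)).trans (dvd_of_eq ?_)
  ring

theorem IsOdoLimit.agree_odoPoint (hd : IsOdometerSeq d) {w : InfWord} (h : IsOdoLimit d w)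
    (n : ℕ) : Agree n w (odoPoint d (prefixVal d n w)) ∧ prefixVal d n w < radixProd d n := by
  obtain ⟨i, hi⟩ := h n
  rw [prefixVal_congr d hi, hd.prefixVal_odoPoint]
  refine ⟨hi.trans ((hd.agree_odoPoint_iff _ _ _).2 (Nat.mod_modEq _ _).symm), ?_⟩
  exact Nat.mod_lt _ (hd.radixProd_pos n)

theorem IsOdoLimit.zero_eq (hd : IsOdometerSeq d) {w : InfWord} (h : IsOdoLimit d w) :
    w 0 = Letter.num (prefixVal d 1 w) ∧ prefixVal d 1 w < 2 := by
  obtain ⟨h1, h2⟩ := h.agree_odoPoint hd 1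
  rw [hd.radixProd_one] at h2
  refine ⟨?_, h2⟩
  rw [h1 0 (by omega), hd.odoPoint_zero_eq, Nat.mod_eq_of_lt h2]

theorem IsOdoLimit.zero_ne_c {w : InfWord} (h : IsOdoLimit d w) : w 0 ≠ Letter.c := by
  obtain ⟨i, hi⟩ := h 1
  rw [hi 0 (by omega)]
  simp [odoPoint]

theorem eq_of_dvd_sub_of_lt {M : ℕ} {a b : ℕ} (ha : a < M) (hb : b < M)
    (h : (M : ℤ) ∣ (b : ℤ) - a) : a = b :=
  Nat.ModEq.eq_of_lt_of_lt (Nat.modEq_iff_dvd.2 h) ha hb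

theorem IsShift.eq (hd : IsOdometerSeq d) {u v : InfWord} (hu : IsOdoLimit d u)
    (hv : IsOdoLimit d v) (h : IsShift d u v 0) : u = v := by
  refine eq_of_forall_agree fun n => ?_
  obtain ⟨hu1, hu2⟩ := hu.agree_odoPoint hd n
  obtain ⟨hv1, hv2⟩ := hv.agree_odoPoint hd n
  have := eq_of_dvd_sub_of_lt hu2 hv2 (by simpa using h n)
  rw [← this] at hv1
  exact hu1.trans hv1.symm

theorem eq_zero_of_forall_radixProd_dvd (hd : IsOdometerSeq d) {e : ℤ}
    (h : ∀ n, (radixProd d n : ℤ) ∣ e) : e = 0 := by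
  refine Int.eq_zero_of_abs_lt_dvd (h e.natAbs) ?_
  rw [Int.abs_eq_natAbs]
  exact_mod_cast hd.lt_radixProd e.natAbs

/-- One digit cannot tell +1 from -1, since M_1 = 2; two digits can, since M_2 > 2. -/
theorem unit_eq_of_radixProd_two_dvd (hd : IsOdometerSeq d) {e f : ℤ} (he : e = 1 ∨ e = -1)
    (hf : f = 1 ∨ f = -1) (h : (radixProd d 2 : ℤ) ∣ e - f) : e = f := by
  have h2 : 2 < radixProd d 2 := hd.lt_radixProd 2
  have : e - f = 0 := by
    refine Int.eq_zero_of_abs_lt_dvd h ?_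
    rw [abs_lt]
    omega
  omega

theorem LimEdge.isShift (hd : IsOdometerSeq d) {u v : InfWord} (hu : u ∈ odoSpace d)
    (hu' : IsOdoLimit d u) (hv' : IsOdoLimit d v) (h : LimEdge d u v) :
    ∃ e : ℤ, (e = 1 ∨ e = -1) ∧ IsShift d u v e := by
  have step : ∀ {x y : InfWord} {m l e : ℕ}, IsOdoLimit d x → IsOdoLimit d y → IsArcIndex d l e →
      Agree (m + 1) x (cycleVertex d l e) → Agree (m + 1) y (cycleVertex d l (e + 1)) →
      (radixProd d (m + 1) : ℤ) ∣ (prefixVal d (m + 1) y : ℤ) - prefixVal d (m + 1) x - 1 := by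
    intro x y m l e hx hy he h1 h2
    rcases he.cases with rfl | ⟨i, hi, rfl⟩ | rfl
    · rw [cycleVertex_zero] at h1
      exact absurd (h1 0 (by omega)) hx.zero_ne_c
    · rw [cycleVertex_succ hi.le] at h1
      rw [cycleVertex_succ hi] at h2
      rw [prefixVal_congr d h1, prefixVal_congr d h2, hd.prefixVal_odoPoint, hd.prefixVal_odoPoint]
      have : (i % radixProd d (m + 1) + 1) ≡ (i + 1) % radixProd d (m + 1)
          [MOD radixProd d (m + 1)] :=
        ((Nat.mod_modEq _ _).add_right 1).trans (Nat.mod_modEq _ _).symm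
      have := Nat.modEq_iff_dvd.1 this
      rw [sub_sub]
      exact_mod_cast this
    · rw [cycleVertex_last] at h2
      exact absurd (h2 0 (by omega)) hy.zero_ne_c
  have key : ∀ m, ∃ e : ℤ, (e = 1 ∨ e = -1) ∧
      (radixProd d (m + 1) : ℤ) ∣ (prefixVal d (m + 1) v : ℤ) - prefixVal d (m + 1) u - e := by
    intro m
    obtain ⟨l, e, -, he, ⟨h1, h2⟩ | ⟨h1, h2⟩⟩ := h.exists_cycleVertex hd hu hu'.not_isEndpoint m
    · exact ⟨1, Or.inl rfl, step hu' hv' he h1 h2⟩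
    · refine ⟨-1, Or.inr rfl, ?_⟩
      refine ((step hv' hu' he h1 h2).neg_right).trans (dvd_of_eq ?_)
      ring
  -- The sign could depend on the prefix; it is fixed by the first two digits.
  obtain ⟨e, he, h2⟩ := key 1
  refine ⟨e, he, fun n => ?_⟩
  obtain ⟨f, hf, hn⟩ := key (n + 1)
  have h2' := dvd_prefixVal_sub_mono (m := 2) (by omega) hn
  have hef : e = f := by
    refine unit_eq_of_radixProd_two_dvd hd he hf ?_
    refine (h2'.sub h2).trans (dvd_of_eq ?_)
    ring
  rw [hef]
  exact dvd_prefixVal_sub_mono (by omega) hn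

/-! ### The closure of the graph is bipartite -/

/-- The orbit of the limit of the halves of the periods. -/
def InHalfOrbit (d : ℕ → ℕ) (w : InfWord) : Prop :=
  ∃ e : ℤ, ∀ n, (radixProd d (n + 1) : ℤ) ∣ (prefixVal d (n + 1) w : ℤ) - oddPart d n - e

theorem IsHalf.inHalfOrbit (hd : IsOdometerSeq d) {w : InfWord} (h : IsHalf d w) :
    InHalfOrbit d w := by
  refine ⟨0, fun n => ?_⟩
  rw [prefixVal_congr d (h n), hd.prefixVal_odoPoint, sub_zero]
  exact Nat.modEq_iff_dvd.1 (Nat.mod_modEq _ _).symm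

/-- Twice the half point is zero because 2 P_n = M_{n+1}. If it were an integer shift of 0^∞, twice
that integer would be divisible by every M_n, so the shift would vanish, against the oddness of P_0
= 1. -/
theorem not_inHalfOrbit_odoPoint_zero (hd : IsOdometerSeq d) : ¬ InHalfOrbit d (odoPoint d 0) := by
  rintro ⟨e, he⟩
  simp only [hd.prefixVal_odoPoint, Nat.zero_mod] at he
  have h2 : 2 * e = 0 := by
    refine eq_zero_of_forall_radixProd_dvd hd fun n => ?_
    refine (Int.natCast_dvd_natCast.2 (radixProd_dvd d n.le_succ)).trans ?_
    refine (((he n).mul_left (-2)).sub (dvd_refl (radixProd d (n + 1) : ℤ))).trans (dvd_of_eq ?_)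
    rw [hd.radixProd_succ_eq]
    push_cast
    ring
  have h0 := he 0
  rw [zero_add, hd.radixProd_one] at h0
  have : oddPart d 0 = 1 := by simp [oddPart, halfLength]
  rw [this] at h0
  push_cast at h0
  omega

theorem IsShift.inHalfOrbit {u v : InfWord} {e : ℤ} (h : IsShift d u v e) (hu : InHalfOrbit d u) :
    InHalfOrbit d v := by
  obtain ⟨f, hf⟩ := hu
  refine ⟨f + e, fun n => ?_⟩
  refine ((hf n).add (h (n + 1))).trans (dvd_of_eq ?_)
  ring

open Classical in
/-- A two-coloring of the closure of the graph. -/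
noncomputable def limColor (d : ℕ → ℕ) (w : InfWord) : Bool :=
  if IsEndpoint d w then decide (∃ l e, IsArcIndex d l e ∧ w = arcSource d l e)
  else if w 0 = Letter.c then true
  else if InHalfOrbit d w then decide (w 0 = Letter.num 0)
  else decide (w 0 = Letter.num 1)

theorem limColor_cInf (d : ℕ → ℕ) : limColor d cInf = true := by
  rw [limColor, if_neg not_isEndpoint_cInf]
  exact if_pos rfl

theorem limColor_ne_of_cInf (hd : IsOdometerSeq d) {v : InfWord} (h : LimEdge d cInf v) :
    limColor d cInf ≠ limColor d v := by
  rw [limColor_cInf]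
  have hv := h.not_isEndpoint hd not_isEndpoint_cInf
  rcases h.of_cInf hd with ⟨h0, rfl⟩ | ⟨h0, h1⟩
  · simp [limColor, hv, h0, not_inHalfOrbit_odoPoint_zero hd]
  · simp [limColor, hv, h0, h1.inHalfOrbit hd]

/-- Inside the odometer, limit edges are shifts by ±1, which stay in an orbit and change the parity.
The two neighbors of c^∞ have opposite parities but lie in different orbits, so exchanging the
colors on the orbit of the half point gives them the same color. -/
theorem LimEdge.limColor_ne (hd : IsOdometerSeq d) {u v : InfWord} (hu : u ∈ odoSpace d)
    (hv : v ∈ odoSpace d) (h : LimEdge d u v) : limColor d u ≠ limColor d v := by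
  classical
  by_cases hue : IsEndpoint d u
  · have main : ∀ x y, OdoArc d x y → limColor d x ≠ limColor d y := by
      intro x y hxy
      obtain ⟨l, e, he, rfl, rfl⟩ := odoArc_iff.1 hxy
      have h1 : ∃ l' e', IsArcIndex d l' e' ∧ arcSource d l e = arcSource d l' e' :=
        ⟨l, e, he, rfl⟩
      have h2 : ¬ ∃ l' e', IsArcIndex d l' e' ∧ arcTarget d l e = arcSource d l' e' := by
        rintro ⟨l', e', -, h⟩
        exact arcSource_ne_arcTarget _ _ _ _ _ h.symm
      rw [limColor, if_pos (isEndpoint_arcSource he), decide_eq_true h1, limColor,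
        if_pos (isEndpoint_arcTarget he), decide_eq_false h2]
      decide
    rcases h.odoEdge hd hue with h | h
    · exact main _ _ h
    · exact (main _ _ h).symm
  have hve := h.not_isEndpoint hd hue
  rcases mem_odoSpace_cases hd hu with h' | rfl | hu'
  · exact absurd h' hue
  · exact limColor_ne_of_cInf hd h
  rcases mem_odoSpace_cases hd hv with h' | rfl | hv'
  · exact absurd h' hve
  · exact (limColor_ne_of_cInf hd h.symm).symm
  obtain ⟨e, he, hs⟩ := h.isShift hd hu hu' hv'
  have horb : InHalfOrbit d v ↔ InHalfOrbit d u := ⟨hs.symm.inHalfOrbit, hs.inHalfOrbit⟩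
  obtain ⟨hu1, hu2⟩ := hu'.zero_eq hd
  obtain ⟨hv1, hv2⟩ := hv'.zero_eq hd
  have hs1 := hs 1
  rw [hd.radixProd_one] at hs1
  rw [limColor, if_neg hue, if_neg hu'.zero_ne_c, limColor, if_neg hve, if_neg hv'.zero_ne_c, horb,
    hu1, hv1]
  generalize prefixVal d 1 u = a at *
  generalize prefixVal d 1 v = b at *
  have hab : a = 0 ∧ b = 1 ∨ a = 1 ∧ b = 0 := by
    push_cast at hs1
    omega
  rcases hab with ⟨rfl, rfl⟩ | ⟨rfl, rfl⟩ <;> split_ifs <;> simp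

/-- The neighbors of a vertex in the closure of the graph are determined by two letters. -/
theorem LimEdge.eq_of_agree (hd : IsOdometerSeq d) {w u v : InfWord} (hw : w ∈ odoSpace d)
    (hu : u ∈ odoSpace d) (hv : v ∈ odoSpace d) (h : LimEdge d w u) (h' : LimEdge d w v)
    (huv : Agree 2 u v) : u = v := by
  by_cases hwe : IsEndpoint d w
  · exact (h.odoEdge hd hwe).unique hd (h'.odoEdge hd hwe)
  have hue := h.not_isEndpoint hd hwe
  have hve := h'.not_isEndpoint hd hwe
  have h0 : u 0 = v 0 := huv 0 (by omega)
  rcases mem_odoSpace_cases hd hw with hw' | rfl | hw'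
  · exact absurd hw' hwe
  · rcases h.of_cInf hd with ⟨h1, h2⟩ | ⟨h1, h2⟩ <;> rcases h'.of_cInf hd with ⟨h3, h4⟩ | ⟨h3, h4⟩
    · rw [h2, h4]
    · rw [h1, h3] at h0
      simp at h0
    · rw [h1, h3] at h0
      simp at h0
    · exact h2.unique h4
  rcases mem_odoSpace_cases hd hu with hu' | rfl | hu'
  · exact absurd hu' hue
  · rcases mem_odoSpace_cases hd hv with hv' | rfl | hv'
    · exact absurd hv' hve
    · rfl
    · exact absurd h0.symm hv'.zero_ne_c
  rcases mem_odoSpace_cases hd hv with hv' | rfl | hv'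
  · exact absurd hv' hve
  · exact absurd h0 hu'.zero_ne_c
  obtain ⟨e, he, hs⟩ := h.isShift hd hw hw' hu'
  obtain ⟨f, hf, hs'⟩ := h'.isShift hd hw hw' hv'
  have hef : f = e := by
    refine unit_eq_of_radixProd_two_dvd hd hf he ?_
    refine ((hs 2).sub (hs' 2)).trans (dvd_of_eq ?_)
    rw [prefixVal_congr d huv]
    ring
  refine IsShift.eq hd hu' hv' ?_
  have := hs.symm.trans hs'
  rwa [hef, neg_add_cancel] at this

end

/-! ### Continuous homomorphisms between odometer graphs -/

section

variable {d d' : ℕ → ℕ}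

/-- The image of a point of the orbit of `0^∞`. -/
def orbitImage (hd : IsOdometerSeq d) (φ : odoSpace d → odoSpace d') (i : ℕ) : InfWord :=
  (φ ⟨odoPoint d i, odoPoint_mem hd i⟩).1

theorem orbitImage_mem (hd : IsOdometerSeq d) (φ : odoSpace d → odoSpace d') (i : ℕ) :
    orbitImage hd φ i ∈ odoSpace d' := (φ _).2

variable {φ : odoSpace d → odoSpace d'}

theorem exists_orbitImage_agree (hd : IsOdometerSeq d) (hφ : Continuous φ) (m : ℕ) :
    ∃ k, ∀ i j, i ≡ j [MOD radixProd d k] →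
      Agree m (orbitImage hd φ i) (orbitImage hd φ j) := by
  obtain ⟨k, hk⟩ := exists_uniform_prefix_of_continuous hd (continuous_subtype_val.comp hφ) m
  exact ⟨k, fun i j hij => hk _ _ ((hd.agree_odoPoint_iff k i j).2 hij)⟩

theorem exists_agree_edge (hd : IsOdometerSeq d) (hφ : Continuous φ)
    (hadj : ∀ x y : odoSpace d, OdoEdge d x.1 y.1 → OdoEdge d' (φ x).1 (φ y).1) (m : ℕ) :
    ∃ k, ∀ l e, k ≤ l → IsArcIndex d l e → ∃ x y, OdoEdge d' x y ∧
      Agree m (φ ⟨_, cycleVertex_mem hd l e⟩).1 x ∧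
      Agree m (φ ⟨_, cycleVertex_mem hd l (e + 1)⟩).1 y := by
  obtain ⟨k, hk⟩ := exists_uniform_prefix_of_continuous hd (continuous_subtype_val.comp hφ) m
  refine ⟨k, fun l e hl he => ?_⟩
  refine ⟨_, _, hadj ⟨_, (isEndpoint_arcSource he).mem⟩ ⟨_, (isEndpoint_arcTarget he).mem⟩
    (Or.inl (odoArc_arc he)), ?_, ?_⟩
  · exact hk _ ⟨_, (isEndpoint_arcSource he).mem⟩ ((agree_arcSource e).symm.mono (by omega))
  · exact hk _ ⟨_, (isEndpoint_arcTarget he).mem⟩ ((agree_arcTarget e).symm.mono (by omega))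

/-- The arcs number i + 1 converge to this pair of orbit points as the level grows, and their images
are edges. -/
theorem limEdge_orbitImage (hd : IsOdometerSeq d) (hφ : Continuous φ)
    (hadj : ∀ x y : odoSpace d, OdoEdge d x.1 y.1 → OdoEdge d' (φ x).1 (φ y).1) (i : ℕ) :
    LimEdge d' (orbitImage hd φ i) (orbitImage hd φ (i + 1)) := by
  intro m
  obtain ⟨k, hk⟩ := exists_agree_edge hd hφ hadj m
  have hi : i < oddPart d (max k i) := (le_max_right k i).trans_lt (hd.lt_oddPart _)
  have := hk (max k i) (i + 1) (le_max_left _ _) (by unfold IsArcIndex; omega)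
  simp only [cycleVertex_succ hi.le, cycleVertex_succ (Nat.succ_le_of_lt hi)] at this
  exact this

theorem limEdge_cInf_orbitImage (hd : IsOdometerSeq d) (hφ : Continuous φ)
    (hadj : ∀ x y : odoSpace d, OdoEdge d x.1 y.1 → OdoEdge d' (φ x).1 (φ y).1) :
    LimEdge d' (φ ⟨cInf, cInf_mem d⟩).1 (orbitImage hd φ 0) := by
  intro m
  obtain ⟨k, hk⟩ := exists_agree_edge hd hφ hadj m
  have := hk k 0 le_rfl (Nat.zero_le _)
  simp only [cycleVertex_zero, cycleVertex_succ (Nat.zero_le _)] at this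
  exact this

/-- Otherwise the images of all the points o^{P_l}(0^∞) with l ≥ k would coincide, and the image of
the cycle of level k would be an odd closed walk in the bipartite closure of the graph. -/
theorem not_forall_modEq_orbitImage_eq (hd : IsOdometerSeq d) (hd' : IsOdometerSeq d')
    (hφ : Continuous φ)
    (hadj : ∀ x y : odoSpace d, OdoEdge d x.1 y.1 → OdoEdge d' (φ x).1 (φ y).1) (k : ℕ) :
    ¬ ∀ i j, i ≡ j [MOD radixProd d k] → orbitImage hd φ i = orbitImage hd φ j := by
  intro h
  refine not_forall_ne_succ_of_cycle (d := d) (l := k)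
    (F := fun e => limColor d' (φ ⟨_, cycleVertex_mem hd k e⟩).1) (by simp) fun e he => ?_
  refine LimEdge.limColor_ne hd' (φ _).2 (φ _).2 ?_
  rcases he.cases with rfl | ⟨i, hi, rfl⟩ | rfl
  · simp only [cycleVertex_zero, cycleVertex_succ (Nat.zero_le _)]
    exact limEdge_cInf_orbitImage hd hφ hadj
  · simp only [cycleVertex_succ hi.le, cycleVertex_succ (Nat.succ_le_of_lt hi)]
    exact limEdge_orbitImage hd hφ hadj i
  · simp only [cycleVertex_last, cycleVertex_succ le_rfl]
    intro m
    obtain ⟨k', hk'⟩ := exists_agree_edge hd hφ hadj m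
    have h1 := hk' (max k k') (oddPart d (max k k') + 1) (le_max_right _ _) le_rfl
    simp only [cycleVertex_last, cycleVertex_succ le_rfl] at h1
    have h2 := h (oddPart d (max k k')) (oddPart d k)
      ((hd.oddPart_modEq (le_max_left k k')).of_dvd (radixProd_dvd d k.le_succ))
    unfold orbitImage at h2
    rwa [h2] at h1

theorem orbitImage_add_ne (hd : IsOdometerSeq d) (hd' : IsOdometerSeq d') (hφ : Continuous φ)
    (hadj : ∀ x y : odoSpace d, OdoEdge d x.1 y.1 → OdoEdge d' (φ x).1 (φ y).1) {k : ℕ}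
    (hk : ∀ i j, i ≡ j [MOD radixProd d k] → Agree 2 (orbitImage hd φ i) (orbitImage hd φ j))
    (i : ℕ) : orbitImage hd φ (i + radixProd d k) ≠ orbitImage hd φ i := by
  intro hi
  have hstep := limEdge_orbitImage hd hφ hadj
  have hmem := orbitImage_mem hd φ
  -- Neighbors that share two letters are equal, so one coincidence propagates backwards down to the
  -- index 0, then forwards to all indices.
  have hper : Function.Periodic (orbitImage hd φ) (radixProd d k) := by
    intro j
    have hz : orbitImage hd φ (0 + radixProd d k) = orbitImage hd φ 0 := by
      induction i with
      | zero => exact hi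
      | succ i ih =>
        refine ih ?_
        have h1 := (hstep (i + radixProd d k)).symm
        have h2 := (hstep i).symm
        rw [show i + radixProd d k + 1 = i + 1 + radixProd d k by ring, hi] at h1
        exact h1.eq_of_agree hd' (hmem _) (hmem _) (hmem _) h2 (hk _ _ (by simp))
    induction j with
    | zero => exact hz
    | succ j ih =>
      have h1 := hstep (j + radixProd d k)
      rw [show j + radixProd d k + 1 = j + 1 + radixProd d k by ring, ih] at h1
      exact h1.eq_of_agree hd' (hmem _) (hmem _) (hmem _) (hstep j) (hk _ _ (by simp))
  refine not_forall_modEq_orbitImage_eq hd hd' hφ hadj k fun i j hij => ?_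
  rw [← hper.map_mod_nat i, ← hper.map_mod_nat j, hij]

/-- An isolated image, or the image c^∞, would be taken again after some period M_k by uniform
continuity, contrary to `orbitImage_add_ne`. -/
theorem isOdoLimit_orbitImage (hd : IsOdometerSeq d) (hd' : IsOdometerSeq d') (hφ : Continuous φ)
    (hadj : ∀ x y : odoSpace d, OdoEdge d x.1 y.1 → OdoEdge d' (φ x).1 (φ y).1) (i : ℕ) :
    IsOdoLimit d' (orbitImage hd φ i) := by
  have hmem := orbitImage_mem hd φ
  have hend : ∀ i, ¬ IsEndpoint d' (orbitImage hd φ i) := by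
    intro i hi
    obtain ⟨n, hn⟩ := hi.exists_isolated hd'
    obtain ⟨k, hk⟩ := exists_orbitImage_agree hd hφ (max n 2)
    refine orbitImage_add_ne hd hd' hφ hadj
      (fun i j hij => (hk i j hij).mono (le_max_right _ _)) i ?_
    exact hn _ (hmem _) ((hk i _ (by simp)).mono (le_max_left _ _))
  rcases mem_odoSpace_cases hd' (hmem i) with h | h | h
  · exact absurd h (hend i)
  · exfalso
    obtain ⟨k, hk⟩ := exists_orbitImage_agree hd hφ 2
    refine orbitImage_add_ne hd hd' hφ hadj hk i ?_
    have h0 := hk (i + radixProd d k) i (by simp) 0 (by omega)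
    rw [h] at h0
    rcases mem_odoSpace_cases hd' (hmem (i + radixProd d k)) with h' | h' | h'
    · exact absurd h' (hend _)
    · rw [h, h']
    · exact absurd h0 h'.zero_ne_c
  · exact h

/-- A continuous homomorphism induces a divisibility relation. -/
theorem exists_dvd_of_contLE (hd : IsOdometerSeq d) (hd' : IsOdometerSeq d')
    (h : (odoTopGraph d).ContLE (odoTopGraph d')) :
    ∃ s : ℤ, s ≠ 0 ∧ ∀ m, ∃ k, (radixProd d' m : ℤ) ∣ s * radixProd d k := by
  obtain ⟨φ, hφ, hadj⟩ : ∃ φ : odoSpace d → odoSpace d', Continuous φ ∧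
    ∀ x y : odoSpace d, OdoEdge d x.1 y.1 → OdoEdge d' (φ x).1 (φ y).1 := h
  have hlim := isOdoLimit_orbitImage hd hd' hφ hadj
  have hmem := orbitImage_mem hd φ
  choose ε hε hs using fun i =>
    (limEdge_orbitImage hd hφ hadj i).isShift hd' (hmem i) (hlim i) (hlim (i + 1))
  obtain ⟨k, hk⟩ := exists_orbitImage_agree hd hφ 2
  -- The sign of a step is read from the first two letters of the images, which are periodic in the
  -- index.
  have hper : Function.Periodic ε (radixProd d k) := by
    intro i
    refine unit_eq_of_radixProd_two_dvd hd' (hε _) (hε _) ?_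
    have h1 := hs (i + radixProd d k) 2
    rw [prefixVal_congr d' (hk (i + radixProd d k) i (by simp)),
      prefixVal_congr d' (hk (i + radixProd d k + 1) (i + 1)
        (Nat.ModEq.add_right 1 (by simp)))] at h1
    refine ((hs i 2).sub h1).trans (dvd_of_eq ?_)
    ring
  have hsum : ∀ i n, IsShift d' (orbitImage hd φ i) (orbitImage hd φ (i + n))
      (∑ j ∈ Finset.range n, ε (i + j)) := by
    intro i n
    induction n with
    | zero => exact IsShift.refl _
    | succ n ih =>
      rw [Finset.sum_range_succ]
      exact ih.trans (hs (i + n))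
  set s := ∑ j ∈ Finset.range (radixProd d k), ε (0 + j) with hsdef
  have hmul : ∀ n : ℕ, IsShift d' (orbitImage hd φ 0) (orbitImage hd φ (n * radixProd d k))
      (n * s) := by
    intro n
    induction n with
    | zero => simpa using IsShift.refl _
    | succ n ih =>
      have h1 := hsum (n * radixProd d k) (radixProd d k)
      have h2 : ∑ j ∈ Finset.range (radixProd d k), ε (n * radixProd d k + j) = s := by
        refine Finset.sum_congr rfl fun j _ => ?_
        rw [add_comm (n * _), zero_add]
        exact hper.nat_mul n j
      rw [h2] at h1
      have h3 := ih.trans h1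
      rw [Nat.succ_mul]
      convert h3 using 1
      push_cast
      ring
  refine ⟨s, fun h0 => ?_, fun m => ?_⟩
  -- A zero total shift over a period would bring the image back to its starting point.
  · refine orbitImage_add_ne hd hd' hφ hadj hk 0 ?_
    have := hmul 1
    rw [h0, mul_zero, one_mul] at this
    rw [zero_add]
    exact (IsShift.eq hd' (hlim _) (hlim _) this).symm
  -- After n periods, where n M_k is a multiple of M_{k₁}, the first m letters return although the
  -- image was shifted by n s; hence M'_m divides n s.
  · obtain ⟨k₁, hk₁⟩ := exists_orbitImage_agree hd hφ m
    obtain ⟨n, hn⟩ := radixProd_dvd d (le_max_left k k₁)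
    refine ⟨max k k₁, ?_⟩
    have h1 := hmul n m
    have h2 : Agree m (orbitImage hd φ (n * radixProd d k)) (orbitImage hd φ 0) := by
      refine hk₁ _ _ ?_
      rw [mul_comm, ← hn]
      exact (Nat.modEq_zero_iff_dvd.2 (radixProd_dvd d (le_max_right k k₁)))
    rw [prefixVal_congr d' h2] at h1
    have h3 : (radixProd d' m : ℤ) ∣ n * s := by
      refine (h1.neg_right).trans (dvd_of_eq ?_)
      ring
    rw [hn]
    refine (h3.mul_right (radixProd d k : ℤ)).trans (dvd_of_eq ?_)
    push_cast
    ring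

end

/-! ### The family of odometers -/

/-- An odd prime number that codes the first `j + 1` values of `α`. -/
noncomputable def codePrime (α : ℕ → Bool) (j : ℕ) : ℕ :=
  Nat.nth Nat.Prime (Encodable.encode ((List.range (j + 1)).map α) + 1)

theorem codePrime_prime (α : ℕ → Bool) (j : ℕ) : (codePrime α j).Prime :=
  Nat.prime_nth_prime _

/-- The index of the prime is a successor, which skips the prime number 0, namely 2. -/
theorem codePrime_ne_two (α : ℕ → Bool) (j : ℕ) : codePrime α j ≠ 2 := by
  intro h
  rw [codePrime, ← Nat.nth_prime_zero_eq_two] at h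
  exact absurd (Nat.nth_injective Nat.infinite_setOfPred_prime h) (by omega)

theorem codePrime_eq {α β : ℕ → Bool} {i j : ℕ} (h : codePrime α i = codePrime β j) :
    i = j ∧ ∀ k ≤ i, α k = β k := by
  have h1 := Nat.nth_injective Nat.infinite_setOfPred_prime h
  have h2 := Encodable.encode_injective (Nat.succ_injective h1)
  have h3 : i = j := by simpa using congrArg List.length h2
  subst h3
  refine ⟨rfl, fun k hk => ?_⟩
  exact List.map_inj_left.1 h2 k (List.mem_range.2 (by omega))

/-- The sequence `2, p₀, p₁, …`, where `p₀, p₁, …` are odd primes coding the initial segments. -/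
noncomputable def codeSeq (α : ℕ → Bool) : ℕ → ℕ
  | 0 => 2
  | j + 1 => codePrime α j

theorem isOdometerSeq_codeSeq (α : ℕ → Bool) : IsOdometerSeq (codeSeq α) := by
  refine ⟨rfl, fun j hj => ?_⟩
  obtain ⟨j, rfl⟩ := Nat.exists_eq_succ_of_ne_zero (by omega : j ≠ 0)
  exact ⟨(codePrime_prime α j).two_le, (codePrime_prime α j).odd_of_ne_two (codePrime_ne_two α j)⟩

/-- Past the first difference of α and β, the primes of β do not occur in the sequence of α, so all
of them would divide the fixed nonzero integer s. -/
theorem not_contLE_codeSeq {α β : ℕ → Bool} (h : α ≠ β) :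
    ¬ (odoTopGraph (codeSeq α)).ContLE (odoTopGraph (codeSeq β)) := by
  intro hle
  obtain ⟨s, hs, hdvd⟩ := exists_dvd_of_contLE (isOdometerSeq_codeSeq α)
    (isOdometerSeq_codeSeq β) hle
  obtain ⟨i, hi⟩ := Function.ne_iff.1 h
  have hinj : Function.Injective (codePrime β) := fun a b hab => (codePrime_eq hab).1
  obtain ⟨m, hm, hm'⟩ : ∃ m, i ≤ m ∧ s.natAbs < codePrime β m :=
    ((Filter.eventually_ge_atTop i).and
      (hinj.nat_tendsto_atTop.eventually_gt_atTop s.natAbs)).exists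
  -- The prime number m of β is the digit bound at the coordinate m + 1, so it divides the product
  -- of the first m + 2 bounds.
  obtain ⟨k, hk⟩ := hdvd (m + 2)
  have hp := codePrime_prime β m
  have h1 : (codePrime β m : ℤ) ∣ s * radixProd (codeSeq α) k := by
    refine Dvd.dvd.trans ?_ hk
    exact Int.natCast_dvd_natCast.2 (Dvd.intro_left _ (radixProd_succ (codeSeq β) (m + 1)).symm)
  rcases (Nat.prime_iff_prime_int.1 hp).dvd_or_dvd h1 with h2 | h2
  · have := Nat.le_of_dvd (Int.natAbs_pos.2 hs) (Int.natCast_dvd.1 h2)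
    omega
  · obtain ⟨j, -, hj⟩ := (hp.prime.dvd_finsetProd_iff _).1 (Int.natCast_dvd_natCast.1 h2)
    rcases j with _ | j
    · exact codePrime_ne_two β m ((Nat.prime_dvd_prime_iff_eq hp Nat.prime_two).1 hj)
    · have := (Nat.prime_dvd_prime_iff_eq hp (codePrime_prime α j)).1 hj
      exact hi ((codePrime_eq this).2 i hm).symm

/-! ### Bases -/

/-- The graph associated with an odometer, in any universe. -/
def liftOdoTopGraph (d : ℕ → ℕ) : TopGraph.{u} where
  carrier := ULift.{u} (odoSpace d)
  graph := (odoTopGraph d).graph.comap ULift.down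

theorem liftOdoTopGraph_injContLE (d : ℕ → ℕ) :
    (liftOdoTopGraph.{u} d).InjContLE (odoTopGraph d) :=
  ⟨ULift.down, ULift.down_injective, continuous_uliftDown, fun _ _ h => h⟩

theorem contLE_liftOdoTopGraph (d : ℕ → ℕ) : (odoTopGraph d).ContLE (liftOdoTopGraph.{u} d) :=
  ⟨ULift.up, continuous_uliftUp, fun _ _ h => h⟩

theorem liftOdoTopGraph_mem_classK {d : ℕ → ℕ} (hd : IsOdometerSeq d) :
    liftOdoTopGraph.{u} d ∈ classK.{u} := by
  refine ⟨?_, (contLE_liftOdoTopGraph d).three_le_ccn (three_le_ccn_odoTopGraph hd)⟩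
  have : CompactSpace (odoSpace d) := isCompact_iff_compactSpace.1 (isCompact_odoSpace hd)
  have h0 : CompactSpace (ULift.{u} (odoSpace d)) := Homeomorph.ulift.symm.compactSpace
  have h2 : TopologicalSpace.MetrizableSpace (ULift.{u} (odoSpace d)) :=
    Homeomorph.ulift.isEmbedding.metrizableSpace
  have h3 : TotallyDisconnectedSpace (ULift.{u} (odoSpace d)) :=
    Homeomorph.ulift.symm.totallyDisconnectedSpace
  have h1 : TopologicalSpace.IsTopologicalBasis {s : Set (ULift.{u} (odoSpace d)) | IsClopen s} :=
    loc_compact_Haus_tot_disc_of_zero_dim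
  exact ⟨h1, h2, h0⟩

theorem TopGraph.InjContLE.trans {X : TopGraph.{u}} {Y : TopGraph.{v}} {Z : TopGraph}
    (h : X.InjContLE Y) (h' : Y.InjContLE Z) : X.InjContLE Z :=
  let ⟨φ, hi, hc, ha⟩ := h
  let ⟨ψ, hi', hc', ha'⟩ := h'
  ⟨ψ ∘ φ, hi'.comp hi, hc'.comp hc, fun _ _ hxy => ha' _ _ (ha _ _ hxy)⟩

theorem TopGraph.ContLE.trans {X : TopGraph.{u}} {Y : TopGraph.{v}} {Z : TopGraph}
    (h : X.ContLE Y) (h' : Y.ContLE Z) : X.ContLE Z :=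
  let ⟨φ, hc, ha⟩ := h
  let ⟨ψ, hc', ha'⟩ := h'
  ⟨ψ ∘ φ, hc'.comp hc, fun _ _ hxy => ha' _ _ (ha _ _ hxy)⟩

/-- If one member of the basis lies below the graphs of α and β, minimality puts it above the graph
of α, which is then below that of β. The lifted copies only serve to bring the graphs into the
universe of the basis. -/
theorem continuum_le_mk_of_isInjBasisForK {B : Set TopGraph.{u}} (hB : IsInjBasisForK B) :
    𝔠 ≤ #B := by
  have key : ∀ α : ℕ → Bool, ∃ Y : B, Y.1.InjContLE (odoTopGraph (codeSeq α)) := by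
    intro α
    obtain ⟨Y, hY, hle⟩ := hB.2 _ (liftOdoTopGraph_mem_classK (isOdometerSeq_codeSeq α))
    exact ⟨⟨Y, hY⟩, hle.trans (liftOdoTopGraph_injContLE _)⟩
  choose Y hY using key
  have hinj : Function.Injective Y := by
    intro α β hαβ
    by_contra hne
    have h1 := injContLE_of_injContLE (isOdometerSeq_codeSeq α) (hB.1 (Y α).2) (hY α)
    have h2 := hY β
    rw [← hαβ] at h2
    exact not_contLE_codeSeq hne (h1.contLE.trans h2.contLE)
  have := Cardinal.mk_le_of_injective (f := fun α : ULift.{u + 1} (ℕ → Bool) => Y α.down)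
    (hinj.comp ULift.down_injective)
  simpa using this

theorem theorem1p5 :
    (∃ d : (ℕ → Bool) → ℕ → ℕ, (∀ α, IsOdometerSeq (d α)) ∧
      (∀ α β, α ≠ β → ¬ (odoTopGraph (d α)).ContLE (odoTopGraph (d β))) ∧
      (∀ α β, α ≠ β → ¬ (odoTopGraph (d α)).InjContLE (odoTopGraph (d β))) ∧
      ∀ α,
        (odoTopGraph (d α)).IsZeroDimMetrizableCompact ∧
        ((odoTopGraph (d α)).edges.Countable ∧
          (odoTopGraph (d α)).edges ∈
            D2Closed ((odoTopGraph (d α)).carrier × (odoTopGraph (d α)).carrier) ∧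
          (odoTopGraph (d α)).ccn = 3 ∧
          (odoTopGraph (d α)).chromaticNumber (OpenPlusClosed (odoTopGraph (d α)).carrier) = 2 ∧
          (odoTopGraph (d α)).DegreeLEOne) ∧
        IsInjMinimalInK.{u, 0} (odoTopGraph (d α))) ∧
    ∀ B : Set TopGraph.{u}, IsInjBasisForK B → 𝔠 ≤ #B := by
  refine ⟨⟨codeSeq, isOdometerSeq_codeSeq, fun α β h => not_contLE_codeSeq h,
    fun α β h hle => not_contLE_codeSeq h hle.contLE, fun α => ?_⟩,
    fun B => continuum_le_mk_of_isInjBasisForK⟩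
  have hd := isOdometerSeq_codeSeq α
  exact ⟨isZeroDimMetrizableCompact_odoTopGraph hd, ⟨countable_edges_odoTopGraph _,
    edges_odoTopGraph_mem_D2Closed hd, ccn_odoTopGraph hd,
    chromaticNumber_openPlusClosed_odoTopGraph hd, degreeLEOne_odoTopGraph hd⟩,
    isInjMinimalInK_odoTopGraph hd⟩
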